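/- Let $p\ge 0$ and let $\Gamma$ be the Abelian group generated by $p$ independent hyperbolic transformations $\gamma_1,\dots,\gamma_p\in SU(1,1)$ of the unit disc $\mathbb D$ with the same two fixed points $\xi_1\neq\xi_2$ on the unit circle and with multipliers in $(0,1)$ (so $\frac{\gamma_i(z)-\xi_1}{\gamma_i(z)-\xi_2}=\alpha_i\frac{z-\xi_1}{z-\xi_2}$ with $0<\alpha_i<1$). Independence means that $\gamma^n:=\gamma_1^{n_1}\circ\cdots\circ\gamma_p^{n_p}$, $n\in\mathbb Z^p$, is the identity only for $n=0$. Consider $\Gamma$ as a discrete group, let $\Gamma_+=\{\gamma^{\alpha}:\alpha\in\mathbb N_0^p\}$ (for $p=1$: the identity and the elements of multiplier less than one), and let $\ell_2(\Gamma_+)\subset\ell_2(\Gamma)$ be the subspace of functions vanishing off $\Gamma_+$. Let $\widehat\mu$ be the Haar probability measure of the dual group $\widehat\Gamma$, and let $\nu$ be a finite positive measure on $\mathbb T^p$ with $\int_{\widehat\Gamma}\sigma(\gamma_1)^{n_1}\cdots\sigma(\gamma_p)^{n_p}\,d\widehat\mu(\sigma)=\int_{\mathbb T^p}e^{in_1\theta_1}\cdots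 e^{in_p\theta_p}\,d\nu(\theta)$ for all $n\in\mathbb Z^p$. For $u\in\ell_2(\Gamma)$ put $\widehat u(\sigma)=\sum_{\gamma\in\Gamma}u(\gamma)\sigma(\gamma)\in L_2(d\widehat\mu)$, let $\mathbf I:L_2(d\widehat\mu)\to L_2(d\nu)$ be the map $\sum_n c_n\sigma(\gamma^n)\mapsto\sum_n c_nz^n$, and let $\mathbf H_2(d\nu)$ be the closed span in $L_2(d\nu)$ of the powers $z^\alpha$, $\alpha\in\mathbb N_0^p$. Let $\mathbf H_2(\mathbb D)\otimes\mathbf H_2(d\nu)$ be the Hilbert space of the functions $F(z)=\sum_{n\ge0}z^nf_n$ with $f_n\in\mathbf H_2(d\nu)$ and $\|F\|^2=\sum\|f_n\|^2<\infty$. Let $(h_n)_{n\ge0}$ be a sequence in $\ell_2(\Gamma)$ with $\sup_n\|h_n\|<\infty$, consider the system $y_n=\sum_{m=0}^n h_{n-m}\star u_m$, where $(h\star u)(\gamma)=\sum_{\varphi\in\Gamma}h(\gamma\circ\varphi^{-1})u(\varphi)$, and let $\mathscr H(z,z_1,\dots,z_p)=\sum_{n\ge0}z^n\,\mathbf I(\widehat{h_n})(z_1,\dots,z_p)$,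 $z\in\mathbb D$ (convergence in $L_2(d\nu)$). The system is called scale-causal dissipative if (1) for every $n$ the map $u\mapsto h_n\star u$ is a bounded operator from $\ell_2(\Gamma_+)$ into itself, and (2) for all $u_n\in\ell_2(\Gamma_+)$ with $\sum\|u_n\|^2<\infty$ one has $y_n\in\ell_2(\Gamma_+)$ and $\sum\|y_n\|^2\le\sum\|u_n\|^2$. (a) The system is scale-causal dissipative if and only if multiplication by $\mathscr H$ is a contraction from $\mathbf H_2(\mathbb D)\otimes\mathbf H_2(d\nu)$ into itself. (b) Suppose that $\mathbf H_2(d\nu)$ is a reproducing kernel Hilbert space of functions on $\mathbb D^p$ with kernel $K$, the element $z^\alpha$ being the function $z^\alpha$ on $\mathbb D^p$ for every $\alpha\in\mathbb N_0^p$, and that $h_n\in\ell_2(\Gamma_+)$ for all $n$, so that $\mathscr H$ is a function on $\mathbb D^{p+1}$. Then the condition in (a) holds if and only if the kernel $$\frac{1-\mathscr H(z,z_1,\dots,z_p)\,\mathscr H(w,w_1,\dots,w_p)^*}{1-zw^*}\,K(z_1,\dots,z_p,w_1,\dots,w_p)$$ is positive on $\mathbb D^{p+1}$. -/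

import Mathlib

open MeasureTheory
open scoped ComplexConjugate ENNReal InnerProductSpace ComplexOrder

noncomputable section

/-! ## The group `SU(1,1)` and its action on the disc -/

/-- `SU(1,1)`: the complex matrices `(a, b; c, d)` of determinant one with `c = b̄`, `d = ā`. -/
def SU11 : Subgroup (Matrix.SpecialLinearGroup (Fin 2) ℂ) where
  carrier := {M | M 1 0 = conj (M 0 1) ∧ M 1 1 = conj (M 0 0)}
  mul_mem' := by
    rintro A B ⟨hA, hA'⟩ ⟨hB, hB'⟩
    simp only [Set.mem_ofPred_eq, Matrix.SpecialLinearGroup.coe_mul, Matrix.mul_apply,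
      Fin.sum_univ_two, map_add, map_mul, hA, hA', hB, hB', Complex.conj_conj]
    constructor <;> ring
  one_mem' := by simp
  inv_mem' := by
    rintro A ⟨hA, hA'⟩
    simp [Matrix.SpecialLinearGroup.coe_inv, Matrix.adjugate_fin_two, hA, hA']

/-- The linear fractional transformation `z ↦ (a z + b) / (c z + d)`. -/
def mobius (M : SU11) (z : ℂ) : ℂ :=
  (M.1 0 0 * z + M.1 0 1) / (M.1 1 0 * z + M.1 1 1)

/-- The transformation `γ` has fixed points `ξ₁`, `ξ₂` and multiplier `a` with respect to the
ordered pair `(ξ₁, ξ₂)`: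
`(γ(z) - ξ₁) / (γ(z) - ξ₂) = a (z - ξ₁) / (z - ξ₂)` on the disc, with `a > 0`. -/
def HasMultiplier (ξ₁ ξ₂ : Circle) (M : SU11) (a : ℝ) : Prop :=
  0 < a ∧ ∀ z : Complex.UnitDisc,
    (mobius M z - ξ₁) / (mobius M z - ξ₂) = a * (((z : ℂ) - ξ₁) / ((z : ℂ) - ξ₂))

/-- Generators of a free Abelian group of rank `p` of hyperbolic transformations of the disc.
All the transformations have the same two fixed points on the unit circle, and the generators are
zoomings, that is, their multipliers are less than one. -/
structure ScaleGenerators (p : ℕ) where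
  /-- the first common fixed point -/
  ξ₁ : Circle
  /-- the second common fixed point -/
  ξ₂ : Circle
  ne : ξ₁ ≠ ξ₂
  /-- the generators `γ₁, …, γₚ` -/
  gen : Fin p → SU11
  /-- their multipliers -/
  multiplier : Fin p → ℝ
  hasMultiplier : ∀ i, HasMultiplier ξ₁ ξ₂ (gen i) (multiplier i)
  multiplier_lt_one : ∀ i, multiplier i < 1
  comm : ∀ i j, gen i * gen j = gen j * gen i
  /-- independence: `γ₁ ^ n₁ ∘ ⋯ ∘ γₚ ^ nₚ = ι` only if `n₁ = ⋯ = nₚ = 0` -/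
  indep : ∀ n : Fin p → ℤ, (List.ofFn fun i => gen i ^ n i).prod = 1 → n = 0

namespace ScaleGenerators

variable {p : ℕ} (S : ScaleGenerators p)

/-- The group of scales `Γ`, generated by `γ₁, …, γₚ`, as a discrete group. -/
def Grp : Type := Subgroup.closure (Set.range S.gen)

instance : Group S.Grp := inferInstanceAs (Group (Subgroup.closure (Set.range S.gen)))

instance : CommGroup S.Grp where
  mul_comm := by
    have := Subgroup.isMulCommutative_closure (k := Set.range S.gen) (by
      rintro _ ⟨i, rfl⟩ _ ⟨j, rfl⟩
      exact S.comm i j)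
    exact fun a b => this.is_comm.comm a b

instance : TopologicalSpace S.Grp := ⊥

instance : DiscreteTopology S.Grp := ⟨rfl⟩

/-- The element `γ` of `Γ` as a matrix in `SU(1,1)`. -/
def toSU11 : S.Grp →* SU11 := (Subgroup.closure (Set.range S.gen)).subtype

/-- The generator `γᵢ` as an element of `Γ`. -/
def γ (i : Fin p) : S.Grp := ⟨S.gen i, Subgroup.subset_closure ⟨i, rfl⟩⟩

/-- The element `γ ^ n = γ₁ ^ n₁ ∘ ⋯ ∘ γₚ ^ nₚ` of `Γ`. -/
def γpow (n : Fin p → ℤ) : S.Grp := ∏ i, S.γ i ^ n i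

theorem toSU11_injective : Function.Injective S.toSU11 := Subtype.val_injective

theorem toSU11_γpow (n : Fin p → ℤ) :
    S.toSU11 (S.γpow n) = (List.ofFn fun i => S.gen i ^ n i).prod := by
  rw [γpow, ← List.prod_ofFn, map_list_prod, List.map_ofFn]
  rfl

theorem γpow_add (m n : Fin p → ℤ) : S.γpow (m + n) = S.γpow m * S.γpow n := by
  simp [γpow, zpow_add, Finset.prod_mul_distrib]

theorem γpow_zero : S.γpow 0 = 1 := by simp [γpow]

theorem γpow_neg (n : Fin p → ℤ) : S.γpow (-n) = (S.γpow n)⁻¹ := by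
  simp [γpow]

theorem γpow_injective : Function.Injective S.γpow := by
  intro m n h
  have h1 : S.γpow (m - n) = 1 := by
    rw [sub_eq_add_neg, γpow_add, γpow_neg, h, mul_inv_cancel]
  have := S.indep (m - n) (by rw [← toSU11_γpow, h1, map_one])
  exact sub_eq_zero.1 this

theorem γpow_surjective : Function.Surjective S.γpow := by
  have key : ∀ (x : SU11) (hx : x ∈ Subgroup.closure (Set.range S.gen)),
      ∃ n, S.toSU11 (S.γpow n) = x := by
    intro x hx
    induction hx using Subgroup.closure_induction with
    | mem x hx =>
      obtain ⟨i, rfl⟩ := hx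
      refine ⟨Pi.single i 1, ?_⟩
      have : S.γpow (Pi.single i 1) = S.γ i := by
        rw [γpow, Finset.prod_eq_single i]
        · simp
        · intro j _ hj
          simp [Pi.single_eq_of_ne hj]
        · simp
      rw [this]
      rfl
    | one => exact ⟨0, by rw [γpow_zero, map_one]⟩
    | mul x y _ _ hx hy =>
      obtain ⟨m, rfl⟩ := hx
      obtain ⟨n, rfl⟩ := hy
      exact ⟨m + n, by rw [γpow_add, map_mul]⟩
    | inv x _ hx =>
      obtain ⟨m, rfl⟩ := hx
      exact ⟨-m, by rw [γpow_neg, map_inv]⟩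
  intro x
  obtain ⟨n, hn⟩ := key x.1 x.2
  exact ⟨n, S.toSU11_injective hn⟩

/-- The causal scales `Γ₊`: the elements `γ₁ ^ α₁ ∘ ⋯ ∘ γₚ ^ αₚ` with `α₁, …, αₚ ≥ 0`.
For one generator they are the identity and the elements of multiplier less than one, see
`causalScales_one`. -/
def causalScales : Set S.Grp := Set.range fun α : Fin p → ℕ => S.γpow fun i => (α i : ℤ)

theorem _root_.mobius_num_den (M : SU11) (z : Complex.UnitDisc) :
    M.1 1 0 * (z : ℂ) + M.1 1 1 ≠ 0 ∧ ‖mobius M z‖ < 1 := by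
  obtain ⟨M, hc, hd⟩ := M
  have hdet := M.det_coe
  rw [Matrix.det_fin_two, hc, hd] at hdet
  have hdet' : Complex.normSq (M 0 0) - Complex.normSq (M 0 1) = 1 := by
    rw [Complex.mul_conj, Complex.mul_conj] at hdet
    exact_mod_cast hdet
  have key : Complex.normSq (M 1 0 * (z : ℂ) + M 1 1) - Complex.normSq (M 0 0 * z + M 0 1) =
      1 - Complex.normSq z := by
    rw [hc, hd]
    simp only [Complex.normSq_apply, Complex.add_re, Complex.add_im, Complex.mul_re,
      Complex.mul_im, Complex.conj_re, Complex.conj_im] at hdet' ⊢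
    linear_combination (1 - (z : ℂ).re * (z : ℂ).re - (z : ℂ).im * (z : ℂ).im) * hdet'
  have hz := z.normSq_lt_one
  have hden : 0 < Complex.normSq (M 1 0 * (z : ℂ) + M 1 1) := by
    have := Complex.normSq_nonneg (M 0 0 * z + M 0 1)
    linarith
  refine ⟨Complex.normSq_pos.1 hden, ?_⟩
  have hlt : Complex.normSq (mobius ⟨M, hc, hd⟩ z) < 1 := by
    rw [mobius, map_div₀, div_lt_one hden]
    linarith
  rw [Complex.normSq_eq_norm_sq] at hlt
  exact (sq_lt_one_iff₀ (norm_nonneg _)).1 hlt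

theorem _root_.mobius_mul (M N : SU11) (z : Complex.UnitDisc) :
    mobius (M * N) z = mobius M (mobius N z) := by
  have h1 := (mobius_num_den N z).1
  have h2 := (mobius_num_den M (.mk _ (mobius_num_den N z).2)).1
  have h3 := (mobius_num_den (M * N) z).1
  rw [Complex.UnitDisc.coe_mk] at h2
  unfold mobius at h2 ⊢
  simp only [Subgroup.coe_mul, Matrix.SpecialLinearGroup.coe_mul, Matrix.mul_apply,
    Fin.sum_univ_two] at h3 ⊢
  have e : N.1 1 0 * (z : ℂ) + N.1 1 1 ≠ 0 := h1
  rw [div_eq_div_iff h3 h2]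
  field_simp
  ring

theorem _root_.sub_circle_ne_zero {z : ℂ} (hz : ‖z‖ < 1) (ξ : Circle) : z - ξ ≠ 0 := by
  intro h
  rw [sub_eq_zero.1 h, Circle.norm_coe] at hz
  exact lt_irrefl _ hz

theorem _root_.HasMultiplier.mul {ξ₁ ξ₂ : Circle} {M N : SU11} {a b : ℝ}
    (hM : HasMultiplier ξ₁ ξ₂ M a) (hN : HasMultiplier ξ₁ ξ₂ N b) :
    HasMultiplier ξ₁ ξ₂ (M * N) (a * b) := by
  refine ⟨mul_pos hM.1 hN.1, fun z => ?_⟩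
  have := hM.2 (.mk _ (mobius_num_den N z).2)
  rw [Complex.UnitDisc.coe_mk, hN.2] at this
  rw [mobius_mul, this]
  push_cast
  ring

theorem _root_.HasMultiplier.one (ξ₁ ξ₂ : Circle) : HasMultiplier ξ₁ ξ₂ 1 1 :=
  ⟨one_pos, fun z => by simp [mobius]⟩

theorem _root_.HasMultiplier.unique {ξ₁ ξ₂ : Circle} {M : SU11} {a b : ℝ}
    (ha : HasMultiplier ξ₁ ξ₂ M a) (hb : HasMultiplier ξ₁ ξ₂ M b) : a = b := by
  have h0 : ‖(0 : ℂ)‖ < 1 := by simp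
  have h := (ha.2 (.mk 0 h0)).symm.trans (hb.2 (.mk 0 h0))
  rw [Complex.UnitDisc.coe_mk] at h
  have := mul_right_cancel₀
    (div_ne_zero (sub_circle_ne_zero h0 ξ₁) (sub_circle_ne_zero h0 ξ₂)) h
  exact_mod_cast this

theorem _root_.HasMultiplier.inv {ξ₁ ξ₂ : Circle} {M : SU11} {a : ℝ}
    (ha : HasMultiplier ξ₁ ξ₂ M a) : HasMultiplier ξ₁ ξ₂ M⁻¹ a⁻¹ := by
  refine ⟨inv_pos.2 ha.1, fun z => ?_⟩
  have h := ha.2 (.mk _ (mobius_num_den M⁻¹ z).2)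
  rw [Complex.UnitDisc.coe_mk, ← mobius_mul, mul_inv_cancel] at h
  have h1 : mobius 1 z = z := by simp [mobius]
  have ha' : (a : ℂ) ≠ 0 := by exact_mod_cast ha.1.ne'
  rw [h1] at h
  rw [h]
  push_cast
  rw [inv_mul_cancel_left₀ ha']

theorem hasMultiplier_zpow {M : SU11} {ξ₁ ξ₂ : Circle} {a : ℝ}
    (ha : HasMultiplier ξ₁ ξ₂ M a) (n : ℤ) : HasMultiplier ξ₁ ξ₂ (M ^ n) (a ^ n) := by
  have hnat : ∀ k : ℕ, HasMultiplier ξ₁ ξ₂ (M ^ k) (a ^ k) := by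
    intro k
    induction k with
    | zero => simpa using HasMultiplier.one ξ₁ ξ₂
    | succ k ih =>
      rw [pow_succ, pow_succ]
      exact ih.mul ha
  obtain ⟨k, rfl | rfl⟩ := n.eq_nat_or_neg
  · simpa using hnat k
  · simpa using (hnat k).inv

/-- For one generator, `Γ₊` consists of the identity and of the elements of `Γ` whose multiplier
is less than one. -/
theorem causalScales_one (S : ScaleGenerators 1) :
    S.causalScales =
      {g | g = 1 ∨ ∃ a < 1, HasMultiplier S.ξ₁ S.ξ₂ (S.toSU11 g) a} := by
  have hpow : ∀ n : Fin 1 → ℤ, HasMultiplier S.ξ₁ S.ξ₂ (S.toSU11 (S.γpow n))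
      (S.multiplier 0 ^ n 0) := by
    intro n
    rw [toSU11_γpow]
    simpa using hasMultiplier_zpow (S.hasMultiplier 0) (n 0)
  have hpos := (S.hasMultiplier 0).1
  have hlt := S.multiplier_lt_one 0
  ext g
  obtain ⟨n, rfl⟩ := S.γpow_surjective g
  constructor
  · rintro ⟨α, hα⟩
    have hn := S.γpow_injective hα
    by_cases h0 : α 0 = 0
    · left
      rw [← γpow_zero]
      congr 1
      funext i
      rw [Subsingleton.elim i 0, ← hn]
      simp [h0]
    · refine Or.inr ⟨_, ?_, hpow n⟩
      rw [← hn, zpow_natCast]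
      exact pow_lt_one₀ hpos.le hlt h0
  · rintro (h | ⟨a, ha, hm⟩)
    · exact ⟨0, by rw [h, ← S.γpow_zero]; rfl⟩
    · have h1 := hm.unique (hpow n)
      have h2 : 0 < n 0 := by
        by_contra! hle
        have := one_le_zpow_of_nonpos₀ hpos hlt.le hle
        linarith
      refine ⟨fun _ => (n 0).toNat, ?_⟩
      change S.γpow _ = S.γpow n
      congr 1
      funext i
      rw [Subsingleton.elim i 0, Int.toNat_of_nonneg h2.le]

/-! ## Signals and systems -/

/-- `ℓ₂(Γ)` -/
abbrev L2 : Type := lp (fun _ : S.Grp => ℂ) 2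

/-- `ℓ₂(Γ₊)`, as the subspace of the elements of `ℓ₂(Γ)` that vanish off `Γ₊`. -/
def L2Plus : Submodule ℂ S.L2 where
  carrier := {u | ∀ g, g ∉ S.causalScales → u g = 0}
  add_mem' := by
    intro a b ha hb g hg
    simp [ha g hg, hb g hg]
  zero_mem' := by simp
  smul_mem' := by
    intro c a ha g hg
    simp [ha g hg]

/-- The convolution `(h ⋆ u)(γ) = ∑_{φ ∈ Γ} h(γ ∘ φ⁻¹) u(φ)`. -/
def conv (h u : S.L2) (g : S.Grp) : ℂ := ∑' f : S.Grp, h (g * f⁻¹) * u f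

/-- The output `y_n = ∑_{m = 0}^n h_{n - m} ⋆ u_m` of the system with impulse response `h`. -/
def output (h u : ℕ → S.L2) (n : ℕ) (g : S.Grp) : ℂ :=
  ∑ m ∈ Finset.range (n + 1), S.conv (h (n - m)) (u m) g

/-- The system is scale-causal dissipative: the operators `u ↦ h_n ⋆ u` are bounded from
`ℓ₂(Γ₊)` into itself, and `∑ ‖y_n‖² ≤ ∑ ‖u_n‖² < ∞` for all square summable inputs in
`ℓ₂(Γ₊)`. -/
def ScaleCausalDissipative (h : ℕ → S.L2) : Prop :=
  (∀ n, ∃ C : ℝ, ∀ u ∈ S.L2Plus, ∃ v ∈ S.L2Plus, (∀ g, v g = S.conv (h n) u g) ∧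
    ‖v‖ ≤ C * ‖u‖) ∧
  ∀ u : ℕ → S.L2, (∀ n, u n ∈ S.L2Plus) → Summable (fun n => ‖u n‖ ^ 2) →
    ∃ y : ℕ → S.L2, (∀ n, y n ∈ S.L2Plus) ∧ (∀ n g, y n g = S.output h u n g) ∧
      Summable (fun n => ‖y n‖ ^ 2) ∧ ∑' n, ‖y n‖ ^ 2 ≤ ∑' n, ‖u n‖ ^ 2

/-! ## The dual group and the Fourier transform -/

/-- The dual group of `Γ`. -/
abbrev Dual : Type := PontryaginDual S.Grp

instance : MeasurableSpace S.Dual := borel _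

instance : BorelSpace S.Dual := ⟨rfl⟩

/-- The function `σ ↦ σ(γ)` on the dual group. -/
def dualChar (g : S.Grp) : C(S.Dual, ℂ) where
  toFun σ := (σ g : ℂ)
  continuous_toFun := by
    refine continuous_subtype_val.comp ?_
    exact (continuous_eval_const (F := C(S.Grp, Circle)) g).comp
      (ContinuousMonoidHom.isInducing_toContinuousMap S.Grp Circle).continuous

/-- The function `σ ↦ σ(γ)` as an element of `L²` of the dual group. -/
def dualCharLp (μ : Measure S.Dual) [IsFiniteMeasure μ] (g : S.Grp) : Lp ℂ 2 μ := ContinuousMap.toLp 2 μ ℂ (S.dualChar g)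

/-- The Fourier transform `û(σ) = ∑_{γ ∈ Γ} u(γ) σ(γ)`, a series converging in `L²`. -/
def fourier (μ : Measure S.Dual) [IsFiniteMeasure μ] (u : S.L2) : Lp ℂ 2 μ := ∑' g : S.Grp, u g • S.dualCharLp μ g


theorem exists_dual_ne_one {n : Fin p → ℤ} (hn : n ≠ 0) : ∃ σ : S.Dual, σ (S.γpow n) ≠ 1 := by
  obtain ⟨i, hi⟩ := Function.ne_iff.1 hn
  let e : S.Grp ≃ (Fin p → ℤ) := (Equiv.ofBijective _ ⟨S.γpow_injective, S.γpow_surjective⟩).symm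
  have he : ∀ m, e (S.γpow m) = m := fun m => Equiv.ofBijective_symm_apply_apply _ _ m
  let t : Circle := Circle.exp (Real.pi / n i)
  let f : S.Grp →* Circle :=
    { toFun := fun g => t ^ (e g i)
      map_one' := by rw [← S.γpow_zero, he]; simp
      map_mul' := by
        intro a b
        obtain ⟨k, rfl⟩ := S.γpow_surjective a
        obtain ⟨l, rfl⟩ := S.γpow_surjective b
        rw [← S.γpow_add, he, he, he, Pi.add_apply, zpow_add] }
  let σ : S.Dual := (⟨f, continuous_of_discreteTopology⟩ : S.Grp →ₜ* Circle)
  refine ⟨σ, ?_⟩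
  have h1 : σ (S.γpow n) = t ^ (n i) := by
    change t ^ (e (S.γpow n) i) = _
    rw [he]
  have hni : (n i : ℝ) ≠ 0 := by exact_mod_cast hi
  have h2 : t ^ (n i) = Circle.exp Real.pi := by
    rw [← Circle.exp_zsmul]
    congr 1
    simp [zsmul_eq_mul]
    field_simp
  rw [h1, h2]
  intro h
  have := congrArg (fun c : Circle => (c : ℂ)) h
  simp at this
  norm_num at this

theorem integral_dualChar (μ : Measure S.Dual) [μ.IsMulLeftInvariant] {g : S.Grp} (hg : g ≠ 1) :
    ∫ σ, S.dualChar g σ ∂μ = 0 := by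
  obtain ⟨n, rfl⟩ := S.γpow_surjective g
  have hn : n ≠ 0 := by
    rintro rfl
    exact hg S.γpow_zero
  obtain ⟨τ, hτ⟩ := S.exists_dual_ne_one hn
  have h1 := integral_mul_left_eq_self (μ := μ) (fun σ => S.dualChar (S.γpow n) σ) τ
  have h2 : ∀ σ, S.dualChar (S.γpow n) (τ * σ) =
      (τ (S.γpow n) : ℂ) * S.dualChar (S.γpow n) σ := fun σ => by
    change (((τ * σ) (S.γpow n) : Circle) : ℂ) = _
    have : (τ * σ) (S.γpow n) = τ (S.γpow n) * σ (S.γpow n) := rfl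
    rw [this]
    simp [dualChar]
  simp only [h2] at h1
  rw [integral_const_mul] at h1
  have h3 : ((τ (S.γpow n) : ℂ) - 1) * ∫ σ, S.dualChar (S.γpow n) σ ∂μ = 0 := by
    rw [sub_mul, h1, one_mul, sub_self]
  rcases mul_eq_zero.1 h3 with h | h
  · exact absurd (Circle.ext (by simpa using sub_eq_zero.1 h)) hτ
  · exact h

theorem orthonormal_dualCharLp (μ : Measure S.Dual) [IsProbabilityMeasure μ] [μ.IsMulLeftInvariant] :
    Orthonormal ℂ (S.dualCharLp μ) := by
  classical
  rw [orthonormal_iff_ite]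
  intro a b
  rw [dualCharLp, dualCharLp, ContinuousMap.inner_toLp]
  have h : ∀ σ, S.dualChar b σ * conj (S.dualChar a σ) = S.dualChar (a⁻¹ * b) σ := fun σ => by
    simp only [dualChar, ContinuousMap.coe_mk, map_mul, map_inv, Circle.coe_mul,
      Circle.coe_inv_eq_conj]
    ring
  simp only [h]
  split_ifs with hab
  · subst hab
    simp [dualChar]
  · exact S.integral_dualChar μ (fun h => hab (inv_mul_eq_one.1 h))

theorem hasSum_fourier (μ : Measure S.Dual) [IsProbabilityMeasure μ] [μ.IsMulLeftInvariant]
    (u : S.L2) : HasSum (fun g => u g • S.dualCharLp μ g) (S.fourier μ u) := by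
  have := ((S.orthonormal_dualCharLp μ).orthogonalFamily.summable_of_lp u)
  exact Summable.hasSum this

theorem inner_fourier (μ : Measure S.Dual) [IsProbabilityMeasure μ] [μ.IsMulLeftInvariant]
    (u : S.L2) (g : S.Grp) : ⟪S.dualCharLp μ g, S.fourier μ u⟫_ℂ = u g := by
  have h := (S.hasSum_fourier μ u).mapL (innerSL ℂ (S.dualCharLp μ g))
  have h1 : ⟪S.dualCharLp μ g, u g • S.dualCharLp μ g⟫_ℂ = u g := by
    rw [inner_smul_right, inner_self_eq_norm_sq_to_K, (S.orthonormal_dualCharLp μ).1 g]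
    simp
  have h2 := hasSum_single (f := fun f => ⟪S.dualCharLp μ g, u f • S.dualCharLp μ f⟫_ℂ) g
    (fun f hf => by
      rw [inner_smul_right, (S.orthonormal_dualCharLp μ).2 hf.symm, mul_zero])
  rw [← h1]
  exact h.unique h2

/-! ## The measure on the distinguished boundary and the Hermite transform -/

/-- The measure `ν` on the distinguished boundary `𝕋ᵖ` of the polydisc, whose points are
`(e^{iθ₁}, …, e^{iθₚ})`, has the moments
`∫ σ(γ₁)^{n₁} ⋯ σ(γₚ)^{nₚ} dμ(σ) = ∫ e^{i n₁ θ₁} ⋯ e^{i nₚ θₚ} dν(θ)`.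
The points of `𝕋ᵖ` are parametrized by `x = θ / 2π` in `(ℝ / ℤ)ᵖ`, and
`UnitAddTorus.mFourier n` is the function `e^{i n₁ θ₁} ⋯ e^{i nₚ θₚ}`. -/
def HasMoments (μ : Measure S.Dual) (ν : Measure (UnitAddTorus (Fin p))) : Prop :=
  ∀ n : Fin p → ℤ, ∫ σ : S.Dual, ∏ i, ((σ (S.γ i) : ℂ) ^ n i) ∂μ =
    ∫ x, UnitAddTorus.mFourier n x ∂ν

end ScaleGenerators

section Torus

variable {p : ℕ}

/-- The monomial `z₁ ^ n₁ ⋯ zₚ ^ nₚ` in `L²(dν)`. -/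
def torusMonomial (ν : Measure (UnitAddTorus (Fin p))) [IsFiniteMeasure ν] (n : Fin p → ℤ) :
    Lp ℂ 2 ν :=
  ContinuousMap.toLp 2 ν ℂ (UnitAddTorus.mFourier n)

/-- `H₂(dν)`: the closure in `L²(dν)` of the span of the powers `z ^ α`, `α ≥ 0`. -/
def H2 (ν : Measure (UnitAddTorus (Fin p))) [IsFiniteMeasure ν] : Submodule ℂ (Lp ℂ 2 ν) :=
  (Submodule.span ℂ (Set.range fun α : Fin p → ℕ =>
    torusMonomial ν fun i => (α i : ℤ))).topologicalClosure

theorem isClosed_H2 (ν : Measure (UnitAddTorus (Fin p))) [IsFiniteMeasure ν] :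
    IsClosed (H2 ν : Set (Lp ℂ 2 ν)) :=
  Submodule.isClosed_topologicalClosure _

instance (ν : Measure (UnitAddTorus (Fin p))) [IsFiniteMeasure ν] : CompleteSpace (H2 ν) :=
  (isClosed_H2 ν).completeSpace_coe

/-- The power `z ^ α`, `α ≥ 0`, as an element of `H₂(dν)`. -/
def H2Monomial (ν : Measure (UnitAddTorus (Fin p))) [IsFiniteMeasure ν] (α : Fin p → ℕ) :
    H2 ν :=
  ⟨torusMonomial ν fun i => (α i : ℤ),
    Submodule.le_topologicalClosure _ (Submodule.subset_span ⟨α, rfl⟩)⟩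

/-- `H₂(𝔻) ⊗ H₂(dν)`: the `H₂(dν)`-valued Hardy space of the disc, that is, the functions
`F(z) = ∑ zⁿ fₙ` with `fₙ ∈ H₂(dν)` and `‖F‖² = ∑ ‖fₙ‖² < ∞`, given by their coefficients. -/
abbrev HardyTensor (ν : Measure (UnitAddTorus (Fin p))) [IsFiniteMeasure ν] : Type :=
  lp (fun _ : ℕ => H2 ν) 2

/-- The value `F(z) = ∑ zⁿ fₙ` at the point `z` of the disc, a function on `𝕋ᵖ`. -/
def HardyTensor.eval {ν : Measure (UnitAddTorus (Fin p))} [IsFiniteMeasure ν]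
    (F : HardyTensor ν) (z : Complex.UnitDisc) : Lp ℂ 2 ν :=
  ∑' n : ℕ, (z : ℂ) ^ n • (F n : Lp ℂ 2 ν)

/-- Multiplication by the function `(z, ζ) ↦ H(z)(ζ)` on `𝔻 × 𝕋ᵖ` is a contraction from
`H₂(𝔻) ⊗ H₂(dν)` into itself. -/
def IsContractiveMultiplier (ν : Measure (UnitAddTorus (Fin p))) [IsFiniteMeasure ν]
    (H : Complex.UnitDisc → Lp ℂ 2 ν) : Prop :=
  ∀ F : HardyTensor ν, ∃ G : HardyTensor ν, ‖G‖ ≤ ‖F‖ ∧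
    ∀ z, G.eval z =ᵐ[ν] fun x => H z x * F.eval z x

end Torus

namespace ScaleGenerators

variable {p : ℕ} (S : ScaleGenerators p)

/-- The Hermite transform: `f(σ) = ∑ c_n σ(γ ^ n)` is mapped to `∑ c_n z ^ n`. Here
`c_n` is the coefficient of `f` with respect to the orthonormal family `σ ↦ σ(γ ^ n)`. -/
def hermite (μ : Measure S.Dual) [IsFiniteMeasure μ] (ν : Measure (UnitAddTorus (Fin p)))
    [IsFiniteMeasure ν] (f : Lp ℂ 2 μ) : Lp ℂ 2 ν :=
  ∑' n : Fin p → ℤ, ⟪S.dualCharLp μ (S.γpow n), f⟫_ℂ • torusMonomial ν n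

theorem integral_mFourier {μ : Measure S.Dual} [IsProbabilityMeasure μ] [μ.IsMulLeftInvariant]
    {ν : Measure (UnitAddTorus (Fin p))} (hν : S.HasMoments μ ν) (n : Fin p → ℤ) :
    ∫ x, UnitAddTorus.mFourier n x ∂ν = if n = 0 then 1 else 0 := by
  have h : ∀ σ : S.Dual, ∏ i, ((σ (S.γ i) : ℂ) ^ n i) = S.dualChar (S.γpow n) σ := fun σ => by
    change _ = ((σ (∏ i, S.γ i ^ n i) : Circle) : ℂ)
    have := map_prod Circle.coeHom (fun i => σ (S.γ i ^ n i)) Finset.univ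
    rw [map_prod]
    refine Eq.trans ?_ this.symm
    refine Finset.prod_congr rfl fun i _ => ?_
    rw [map_zpow]
    exact (Circle.coe_zpow _ _).symm
  rw [← hν n]
  simp only [h]
  split_ifs with hn
  · subst hn
    simp [dualChar, γpow_zero]
  · exact S.integral_dualChar μ fun h => hn (S.γpow_injective (h.trans S.γpow_zero.symm))

theorem orthonormal_torusMonomial {μ : Measure S.Dual} [IsProbabilityMeasure μ]
    [μ.IsMulLeftInvariant] {ν : Measure (UnitAddTorus (Fin p))} [IsFiniteMeasure ν]
    (hν : S.HasMoments μ ν) : Orthonormal ℂ (torusMonomial ν) := by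
  classical
  rw [orthonormal_iff_ite]
  intro a b
  rw [torusMonomial, torusMonomial, ContinuousMap.inner_toLp]
  have h : ∀ x, UnitAddTorus.mFourier b x * conj (UnitAddTorus.mFourier a x) =
      UnitAddTorus.mFourier (b - a) x := fun x => by
    rw [← UnitAddTorus.mFourier_neg, ← UnitAddTorus.mFourier_add, sub_eq_add_neg]
  simp only [h]
  rw [S.integral_mFourier hν]
  simp only [sub_eq_zero, eq_comm]

theorem hasSum_hermite_fourier {μ : Measure S.Dual} [IsProbabilityMeasure μ]
    [μ.IsMulLeftInvariant] {ν : Measure (UnitAddTorus (Fin p))} [IsFiniteMeasure ν]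
    (hν : S.HasMoments μ ν) (u : S.L2) :
    HasSum (fun n => u (S.γpow n) • torusMonomial ν n) (S.hermite μ ν (S.fourier μ u)) := by
  have hmem : Memℓp (fun n => u (S.γpow n)) 2 := by
    have h0 := (lp.memℓp u).summable (by norm_num)
    refine memℓp_gen ?_
    exact h0.comp_injective S.γpow_injective
  let v : lp (fun _ : Fin p → ℤ => ℂ) 2 := ⟨fun n => u (S.γpow n), hmem⟩
  have h1 := (S.orthonormal_torusMonomial hν).orthogonalFamily.summable_of_lp v
  have h2 : Summable fun n => u (S.γpow n) • torusMonomial ν n := h1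
  have h3 : S.hermite μ ν (S.fourier μ u) = ∑' n, u (S.γpow n) • torusMonomial ν n := by
    simp only [hermite, inner_fourier]
  rw [h3]
  exact h2.hasSum

/-- The Hermite transform of the Fourier transform of an element of `ℓ₂(Γ₊)` is in `H₂(dν)`. -/
theorem hermite_fourier_mem_H2 {μ : Measure S.Dual} [IsProbabilityMeasure μ]
    [μ.IsMulLeftInvariant] {ν : Measure (UnitAddTorus (Fin p))} [IsFiniteMeasure ν]
    (hν : S.HasMoments μ ν) {u : S.L2} (hu : u ∈ S.L2Plus) :
    S.hermite μ ν (S.fourier μ u) ∈ H2 ν := by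
  refine (isClosed_H2 ν).mem_of_tendsto (S.hasSum_hermite_fourier hν u)
    (Filter.Eventually.of_forall fun s => Submodule.sum_mem _ fun n _ => ?_)
  by_cases hn : S.γpow n ∈ S.causalScales
  · obtain ⟨α, hα⟩ := hn
    rw [← S.γpow_injective hα]
    exact Submodule.smul_mem _ _ (H2Monomial ν α).2
  · rw [hu _ hn, zero_smul]
    exact Submodule.zero_mem _

/-- The generalized transfer function `𝓗(z, ·) = ∑ zⁿ I(ĥₙ)` of the system, as a function of
`z ∈ 𝔻` with values in `L²(dν)`. -/
def transferFunction (μ : Measure S.Dual) [IsFiniteMeasure μ]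
    (ν : Measure (UnitAddTorus (Fin p))) [IsFiniteMeasure ν] (h : ℕ → S.L2)
    (z : Complex.UnitDisc) : Lp ℂ 2 ν :=
  ∑' n : ℕ, (z : ℂ) ^ n • S.hermite μ ν (S.fourier μ (h n))

/-- When `h_n ∈ ℓ₂(Γ₊)` for all `n` and the elements of `H₂(dν)` are functions on the polydisc,
the generalized transfer function `𝓗(z, z₁, …, zₚ) = ∑ zⁿ I(ĥₙ)(z₁, …, zₚ)` on `𝔻 ^ (p + 1)`. -/
def transferValue {μ : Measure S.Dual} [IsProbabilityMeasure μ] [μ.IsMulLeftInvariant]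
    {ν : Measure (UnitAddTorus (Fin p))} [IsFiniteMeasure ν] (hν : S.HasMoments μ ν)
    [RKHS ℂ (H2 ν) (Fin p → Complex.UnitDisc) ℂ] {h : ℕ → S.L2} (hh : ∀ n, h n ∈ S.L2Plus)
    (x : Complex.UnitDisc × (Fin p → Complex.UnitDisc)) : ℂ :=
  ∑' n : ℕ, (x.1 : ℂ) ^ n *
    RKHS.coeCLM ℂ (⟨S.hermite μ ν (S.fourier μ (h n)), S.hermite_fourier_mem_H2 hν (hh n)⟩ : H2 ν)
      x.2

/-- The kernel `(1 - 𝓗(z, z₁, …) 𝓗(w, w₁, …)^*) / (1 - z w^*) K(z₁, …, w₁, …)`, where `K` is the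
reproducing kernel of `H₂(dν)`. -/
def transferKernel {μ : Measure S.Dual} [IsProbabilityMeasure μ] [μ.IsMulLeftInvariant]
    {ν : Measure (UnitAddTorus (Fin p))} [IsFiniteMeasure ν] (hν : S.HasMoments μ ν)
    [RKHS ℂ (H2 ν) (Fin p → Complex.UnitDisc) ℂ] {h : ℕ → S.L2} (hh : ∀ n, h n ∈ S.L2Plus) :
    Matrix (Complex.UnitDisc × (Fin p → Complex.UnitDisc))
      (Complex.UnitDisc × (Fin p → Complex.UnitDisc)) ℂ :=
  Matrix.of fun x y =>
    (1 - S.transferValue hν hh x * conj (S.transferValue hν hh y)) /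
      (1 - (x.1 : ℂ) * conj (y.1 : ℂ)) * RKHS.kernel (H2 ν) x.2 y.2 1

/-- A measure with the required moments exists. -/
theorem exists_hasMoments (μ : Measure S.Dual) [IsProbabilityMeasure μ] :
    ∃ ν : Measure (UnitAddTorus (Fin p)), IsProbabilityMeasure ν ∧ S.HasMoments μ ν := by
  let T : S.Dual → UnitAddTorus (Fin p) := fun σ i =>
    (AddCircle.homeomorphCircle (T := 1) one_ne_zero).symm (σ (S.γ i))
  have hT : Continuous T := by
    refine continuous_pi fun i => (Homeomorph.continuous _).comp ?_
    exact (continuous_eval_const (F := C(S.Grp, Circle)) (S.γ i)).comp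
      (ContinuousMonoidHom.isInducing_toContinuousMap S.Grp Circle).continuous
  refine ⟨μ.map T, Measure.isProbabilityMeasure_map hT.aemeasurable, fun n => ?_⟩
  rw [integral_map hT.aemeasurable (UnitAddTorus.mFourier n).continuous.aestronglyMeasurable]
  refine integral_congr_ae (Filter.Eventually.of_forall fun σ => ?_)
  simp only [UnitAddTorus.mFourier, ContinuousMap.coe_mk, T, fourier_apply,
    AddCircle.toCircle_zsmul]
  refine Finset.prod_congr rfl fun i _ => ?_
  rw [← AddCircle.homeomorphCircle_apply one_ne_zero, Homeomorph.apply_symm_apply, Circle.coe_zpow]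

end ScaleGenerators

end

/-! The composite of the Fourier and Hermite transforms sends the point mass at `γ ^ n` to the
monomial `z ^ n`. The moment condition makes the monomials orthonormal in L²(dν), so this composite
is an isometry, and it carries ℓ₂(Γ₊) onto H₂(dν). It turns convolution into multiplication: the
Fourier coefficient at k of the product of the transforms of h and u is `(h ⋆ u)(γ ^ k)`. A product
of two L² functions is a priori only in L¹, so it is handled through its Fourier coefficients, which
determine an element of L¹(dν).

For (a), fix k and regard the k-th Fourier coefficient of 𝓗(z)F(z) as a power series in z. By the
Cauchy product its n-th coefficient is `y_n(γ ^ k)`. Uniqueness of power series then says that G =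
𝓗F holds at every z exactly when the coefficients of G are the outputs of the system
(`forall_eval_ae_eq_mul_iff`), and the norms agree by isometry.

For (b), H₂(𝔻) ⊗ H₂(dν) has the reproducing kernel K / (1 - z w^*), and a multiplier φ is
contractive exactly when (1 - φ φ^*) times the kernel is positive
(`exists_norm_le_inner_eq_mul_iff_posSemidef`). That criterion concerns pointwise products on 𝔻 ^ (p
+ 1), while (a) concerns almost everywhere products on the torus. The two agree by
`ae_eq_mul_iff_evalAt`: products of elements of H₂(dν) have no Fourier coefficients with a negative
index, and the other coefficients are recovered from the values on the polydisc. -/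

noncomputable section

/-! ### Power series in the disc with bounded coefficients. -/

section PowerSeries

variable {X Y : Type*} [NormedAddCommGroup X] [NormedSpace ℂ X] [NormedAddCommGroup Y]
  [NormedSpace ℂ Y]

theorem summable_pow_smul_of_norm_le [CompleteSpace X] {f : ℕ → X} {C : ℝ} (hf : ∀ n, ‖f n‖ ≤ C)
    {z : ℂ} (hz : ‖z‖ < 1) : Summable fun n => z ^ n • f n := by
  refine Summable.of_norm_bounded
    ((summable_geometric_of_lt_one (norm_nonneg z) hz).mul_right C) fun n => ?_
  rw [norm_smul, norm_pow]
  exact mul_le_mul_of_nonneg_left (hf n) (by positivity)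

/-- The Cauchy product of two power series with bounded coefficients, with respect to a bilinear
form. -/
theorem hasSum_pow_mul_bilin (B : X →L[ℂ] Y →L[ℂ] ℂ) {f : ℕ → X} {g : ℕ → Y} {C D : ℝ}
    (hf : ∀ n, ‖f n‖ ≤ C) (hg : ∀ n, ‖g n‖ ≤ D) {z : ℂ} (hz : ‖z‖ < 1) {x : X} {y : Y}
    (hx : HasSum (fun n => z ^ n • f n) x) (hy : HasSum (fun n => z ^ n • g n) y) :
    HasSum (fun n => z ^ n * ∑ m ∈ Finset.range (n + 1), B (f (n - m)) (g m)) (B x y) := by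
  have hC : 0 ≤ C := (norm_nonneg _).trans (hf 0)
  have hgeo := summable_geometric_of_lt_one (norm_nonneg z) hz
  -- Absolute convergence over ℕ × ℕ permits both the iterated summation, which gives B x y, and the
  -- regrouping along antidiagonals, which gives the Cauchy product.
  have hs : Summable fun q : ℕ × ℕ => z ^ q.1 * z ^ q.2 * B (f q.1) (g q.2) := by
    have h1 : Summable fun q : ℕ × ℕ => ‖z‖ ^ q.1 * ‖z‖ ^ q.2 :=
      hgeo.mul_of_nonneg hgeo (fun n => by positivity) fun n => by positivity
    refine Summable.of_norm_bounded (h1.mul_right (‖B‖ * C * D)) fun q => ?_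
    rw [norm_mul, norm_mul, norm_pow, norm_pow]
    refine mul_le_mul_of_nonneg_left ((B.le_opNorm₂ _ _).trans ?_) (by positivity)
    gcongr
    · exact hf _
    · exact hg _
  have h1 : ∀ n, HasSum (fun m => z ^ n * z ^ m * B (f n) (g m)) (B (z ^ n • f n) y) := by
    intro n
    have := hy.mapL (B (z ^ n • f n))
    refine this.congr_fun fun m => ?_
    simp only [map_smul, smul_apply, smul_eq_mul]
    ring
  have h2 : HasSum (fun n => B (z ^ n • f n) y) (B x y) := by
    simpa using hx.mapL (B.flip y)
  have h3 : HasSum (fun q : ℕ × ℕ => z ^ q.1 * z ^ q.2 * B (f q.1) (g q.2)) (B x y) := by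
    have h4 := hs.hasSum
    rwa [(h4.prod_fiberwise h1).unique h2] at h4
  rw [← Equiv.hasSum_iff Finset.HasAntidiagonal.sigmaAntidiagonalEquivProd] at h3
  refine (h3.sigma fun n => hasSum_fintype _).congr_fun fun n => ?_
  rw [← Finset.Nat.sum_antidiagonal_eq_sum_range_succ (fun m l => B (f l) (g m)) n,
    ← Finset.Nat.sum_antidiagonal_swap, Finset.mul_sum, ← Finset.sum_coe_sort]
  refine Finset.sum_congr rfl fun q _ => ?_
  have hq : q.1.1 + q.1.2 = n := Finset.HasAntidiagonal.mem_antidiagonal.1 q.2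
  simp [← hq, pow_add]

/-- The difference of the two series is a power series expansion of the zero function at 0, so its
coefficients vanish. -/
theorem eq_of_hasSum_pow_mul {a b : ℕ → ℂ} {s : Complex.UnitDisc → ℂ}
    (ha : ∀ z : Complex.UnitDisc, HasSum (fun n => (z : ℂ) ^ n * a n) (s z))
    (hb : ∀ z : Complex.UnitDisc, HasSum (fun n => (z : ℂ) ^ n * b n) (s z)) : a = b := by
  have h : HasFPowerSeriesAt (fun _ : ℂ => (0 : ℂ))
      (FormalMultilinearSeries.ofScalars ℂ fun n => a n - b n) 0 := by
    rw [hasFPowerSeriesAt_iff]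
    filter_upwards [Metric.ball_mem_nhds (0 : ℂ) one_pos] with z hz
    have hz' : ‖z‖ < 1 := by simpa using hz
    have := (ha (.mk z hz')).sub (hb (.mk z hz'))
    simpa [mul_sub, FormalMultilinearSeries.coeff_ofScalars] using this
  funext n
  have h1 := congrArg (fun q => q.coeff n) h.eq_zero
  simp only [FormalMultilinearSeries.coeff_ofScalars] at h1
  exact sub_eq_zero.1 (h1.trans (by simp [FormalMultilinearSeries.coeff]))

end PowerSeries

/-! ### Contractive multipliers and positive kernels. -/

section KernelContraction

variable {X E : Type*} [NormedAddCommGroup E] [InnerProductSpace ℂ E] [CompleteSpace E]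

/-- Multiplication by `φ` is contractive on the space with kernel functions `k` if and only if the
kernel `(1 - φ(x) φ(y)^*) ⟪k x, k y⟫` is positive. -/
theorem exists_norm_le_inner_eq_mul_iff_posSemidef (k : X → E) (φ : X → ℂ) :
    (∀ F : E, ∃ G : E, ‖G‖ ≤ ‖F‖ ∧ ∀ x, ⟪k x, G⟫_ℂ = φ x * ⟪k x, F⟫_ℂ) ↔
      (Matrix.of fun x y => (1 - φ x * conj (φ y)) * ⟪k x, k y⟫_ℂ).PosSemidef := by
  -- If multiplication by φ is an operator, its adjoint sends k x to conj (φ x) • k x, that is, A c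
  -- to T c. The quadratic form of the kernel is ‖A c‖² - ‖T c‖², so positivity says that A c ↦ T c
  -- is a contraction.
  let A : (X →₀ ℂ) →ₗ[ℂ] E := Finsupp.linearCombination ℂ k
  let T : (X →₀ ℂ) →ₗ[ℂ] E := Finsupp.linearCombination ℂ fun x => conj (φ x) • k x
  have hA : ∀ c, A c = c.sum fun x a => a • k x := fun c => Finsupp.linearCombination_apply _ _
  have hT : ∀ c, T c = c.sum fun x a => a • conj (φ x) • k x :=
    fun c => Finsupp.linearCombination_apply _ _
  have key : ∀ c : X →₀ ℂ, (c.sum fun i ci => c.sum fun j cj => star ci *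
      (Matrix.of fun x y => (1 - φ x * conj (φ y)) * ⟪k x, k y⟫_ℂ) i j * cj) =
      ((‖A c‖ ^ 2 - ‖T c‖ ^ 2 : ℝ) : ℂ) := by
    intro c
    have h1 : ((‖A c‖ ^ 2 - ‖T c‖ ^ 2 : ℝ) : ℂ) = ⟪A c, A c⟫_ℂ - ⟪T c, T c⟫_ℂ := by
      rw [inner_self_eq_norm_sq_to_K, inner_self_eq_norm_sq_to_K]
      push_cast
      rfl
    rw [h1, hA, hT]
    simp only [Finsupp.sum]
    rw [sum_inner, sum_inner]
    simp only [inner_sum, ← Finset.sum_sub_distrib]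
    refine Finset.sum_congr rfl fun i _ => Finset.sum_congr rfl fun j _ => ?_
    simp only [inner_smul_left, inner_smul_right, Matrix.of_apply, RCLike.star_def,
      RCLike.conj_conj]
    ring
  have hpos : (Matrix.of fun x y => (1 - φ x * conj (φ y)) * ⟪k x, k y⟫_ℂ).PosSemidef ↔
      ∀ c, ‖T c‖ ≤ ‖A c‖ := by
    have herm : (Matrix.of fun x y => (1 - φ x * conj (φ y)) * ⟪k x, k y⟫_ℂ).IsHermitian := by
      ext x y
      simp only [Matrix.conjTranspose_apply, Matrix.of_apply, RCLike.star_def, map_mul, map_sub,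
        map_one, RCLike.conj_conj, inner_conj_symm]
      ring
    rw [Matrix.PosSemidef, and_iff_right herm]
    refine forall_congr' fun c => ?_
    rw [key, Complex.zero_le_real, sub_nonneg, sq_le_sq₀ (norm_nonneg _) (norm_nonneg _)]
  rw [hpos]
  constructor
  -- Test the multiplier on F = T c: then ⟪A c, G⟫ = ‖T c‖² while ‖G‖ ≤ ‖T c‖, and Cauchy-Schwarz
  -- gives ‖T c‖ ≤ ‖A c‖.
  · intro H c
    obtain ⟨G, hG, hGk⟩ := H (T c)
    have h1 : ⟪A c, G⟫_ℂ = ⟪T c, T c⟫_ℂ := by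
      rw [hA]
      nth_rewrite 1 [hT]
      simp only [Finsupp.sum, sum_inner]
      refine Finset.sum_congr rfl fun i _ => ?_
      simp only [inner_smul_left, RCLike.conj_conj, hGk]
    have h2 : ‖T c‖ * ‖T c‖ ≤ ‖A c‖ * ‖T c‖ := by
      rw [← inner_self_eq_norm_mul_norm (𝕜 := ℂ), ← h1]
      exact (RCLike.re_le_norm _).trans ((norm_inner_le_norm _ _).trans
        (mul_le_mul_of_nonneg_left hG (norm_nonneg _)))
    rcases (norm_nonneg (T c)).eq_or_lt with h | h
    · rw [← h]; exact norm_nonneg _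
    · exact le_of_mul_le_mul_right h2 h
  · intro H F
    -- The vectors k x need not span a dense subspace of E. The contraction A c ↦ T c is therefore
    -- extended only to the closure M of their span, and its adjoint applied to F gives G.
    let M : Submodule ℂ E := (LinearMap.range A).topologicalClosure
    have : CompleteSpace M := (Submodule.isClosed_topologicalClosure _).completeSpace_coe
    let A' : (X →₀ ℂ) →ₗ[ℂ] M :=
      A.codRestrict M fun c => Submodule.le_topologicalClosure _ ⟨c, rfl⟩
    have hd : DenseRange A' := by
      rintro ⟨m, hm⟩
      refine closure_subtype.2 ?_
      have h1 : (Subtype.val '' Set.range A' : Set E) = LinearMap.range A := by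
        ext e
        simp [A']
      rw [h1]
      exact hm
    have hle : ∀ c, ‖T c‖ ≤ 1 * ‖A' c‖ := fun c => by
      rw [one_mul]; exact H c
    let R : M →L[ℂ] E := T.extendOfNorm A'
    have hR : ∀ c, R (A' c) = T c := fun c => T.extendOfNorm_eq hd ⟨1, hle⟩ c
    have hR1 : ‖R‖ ≤ 1 := R.opNorm_le_bound zero_le_one
      fun m => T.norm_extendOfNorm_apply_le hd 1 hle m
    refine ⟨(R.adjoint F : M), ?_, fun x => ?_⟩
    · calc ‖((R.adjoint F : M) : E)‖ ≤ ‖R.adjoint‖ * ‖F‖ := R.adjoint.le_opNorm F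
        _ ≤ 1 * ‖F‖ := by
          rw [LinearIsometryEquiv.norm_map]; gcongr
        _ = ‖F‖ := one_mul _
    · have h1 : ((A' (Finsupp.single x 1) : M) : E) = k x := by
        simp [A', A]
      have h2 : T (Finsupp.single x 1) = conj (φ x) • k x := by
        simp [T]
      rw [← h1, ← Submodule.coe_inner, ContinuousLinearMap.adjoint_inner_right, hR, h2, h1,
        inner_smul_left, RCLike.conj_conj]

end KernelContraction

/-! ### Products in L²(dν) and their Fourier coefficients. -/

section TorusProducts

variable {p : ℕ} (ν : Measure (UnitAddTorus (Fin p)))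

/-- The product of two elements of `L²(dν)`, as an element of `L¹(dν)`. -/
def mulL1 : Lp ℂ 2 ν →L[ℂ] Lp ℂ 2 ν →L[ℂ] Lp ℂ 1 ν :=
  (ContinuousLinearMap.mul ℂ ℂ).holderL ν 2 2 1

variable {ν} in
theorem coeFn_mulL1 (f g : Lp ℂ 2 ν) : mulL1 ν f g =ᵐ[ν] fun x => f x * g x :=
  (ContinuousLinearMap.mul ℂ ℂ).coeFn_holder f g

variable [IsFiniteMeasure ν]

/-- The integral of an element of `L¹(dν)` against a continuous function. -/
def integralAgainst : C(UnitAddTorus (Fin p), ℂ) →L[ℂ] Lp ℂ 1 ν →L[ℂ] ℂ :=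
  ((ContinuousLinearMap.mul ℂ ℂ).lpPairing ν ∞ 1).comp (ContinuousMap.toLp ∞ ν ℂ)

variable {ν}

theorem integralAgainst_apply (q : C(UnitAddTorus (Fin p), ℂ)) (g : Lp ℂ 1 ν) :
    integralAgainst ν q g = ∫ x, q x * g x ∂ν := by
  rw [integralAgainst, ContinuousLinearMap.comp_apply, ContinuousLinearMap.lpPairing_eq_integral]
  refine integral_congr_ae ?_
  filter_upwards [ContinuousMap.coeFn_toLp (p := ∞) (𝕜 := ℂ) ν q] with x hx
  rw [hx]
  rfl

theorem integralAgainst_mulL1 (q : C(UnitAddTorus (Fin p), ℂ)) (f g : Lp ℂ 2 ν) :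
    integralAgainst ν q (mulL1 ν f g) = ∫ x, q x * (f x * g x) ∂ν := by
  rw [integralAgainst_apply]
  refine integral_congr_ae ?_
  filter_upwards [coeFn_mulL1 f g] with x hx
  rw [hx]

theorem coeFn_torusMonomial (n : Fin p → ℤ) :
    torusMonomial ν n =ᵐ[ν] UnitAddTorus.mFourier n :=
  ContinuousMap.coeFn_toLp ν _

/-- Indicators of closed sets are pointwise limits of continuous functions bounded by one. By
dominated convergence g has zero integral over every closed set, and this forces g = 0. -/
theorem L1_eq_zero_of_integralAgainst {g : Lp ℂ 1 ν} (hg : ∀ q, integralAgainst ν q g = 0) :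
    g = 0 := by
  rw [Lp.eq_zero_iff_ae_eq_zero]
  have hint : Integrable g ν := L1.integrable_coeFn g
  refine ae_eq_zero_of_forall_setIntegral_isClosed_eq_zero hint fun s hs => ?_
  let q : ℕ → C(UnitAddTorus (Fin p), ℂ) := fun n =>
    ⟨fun x => ((hs.apprSeq n x : NNReal) : ℂ), by fun_prop⟩
  have hlim : Filter.Tendsto (fun n => ∫ x, q n x * g x ∂ν) Filter.atTop
      (nhds (∫ x, s.indicator g x ∂ν)) := by
    refine tendsto_integral_of_dominated_convergence (fun x => ‖g x‖)
      (fun n => (q n).continuous.aestronglyMeasurable.mul hint.1) hint.norm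
      (fun n => .of_forall fun x => ?_) (.of_forall fun x => ?_)
    · rw [norm_mul]
      refine mul_le_of_le_one_left (norm_nonneg _) ?_
      have := HasOuterApproxClosed.apprSeq_apply_le_one hs n x
      simpa [q] using this
    · have h1 := (tendsto_pi_nhds.1 (HasOuterApproxClosed.tendsto_apprSeq hs)) x
      have h2 : Filter.Tendsto (fun n => q n x) Filter.atTop
          (nhds (((s.indicator (fun _ => (1 : NNReal)) x : NNReal) : ℝ) : ℂ)) :=
        (Complex.continuous_ofReal.tendsto _).comp ((NNReal.continuous_coe.tendsto _).comp h1)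
      have h3 := h2.mul_const (g x)
      convert h3 using 2
      by_cases hx : x ∈ s <;> simp [hx]
  rw [integral_indicator hs.measurableSet] at hlim
  refine tendsto_nhds_unique hlim ?_
  have : ∀ n, ∫ x, q n x * g x ∂ν = 0 := fun n => by rw [← integralAgainst_apply, hg]
  simp [this]

/-- An element of `L¹(dν)` is determined by its Fourier coefficients. -/
theorem L1_ext_mFourier {f g : Lp ℂ 1 ν}
    (h : ∀ k, integralAgainst ν (UnitAddTorus.mFourier (-k)) f =
      integralAgainst ν (UnitAddTorus.mFourier (-k)) g) : f = g := by
  rw [← sub_eq_zero]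
  refine L1_eq_zero_of_integralAgainst fun q => ?_
  -- Trigonometric polynomials are uniformly dense, and the continuous functions annihilating f - g
  -- form a closed subspace.
  have hq : q ∈ (Submodule.span ℂ (Set.range (UnitAddTorus.mFourier (d := Fin p)))).topologicalClosure := by
    rw [UnitAddTorus.span_mFourier_closure_eq_top]
    trivial
  have hker : (Submodule.span ℂ (Set.range (UnitAddTorus.mFourier (d := Fin p)))).topologicalClosure
      ≤ LinearMap.ker ((integralAgainst ν).flip (f - g)).toLinearMap := by
    refine Submodule.topologicalClosure_minimal _ (Submodule.span_le.2 ?_)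
      ((integralAgainst ν).flip (f - g)).isClosed_ker
    rintro _ ⟨k, rfl⟩
    have := h (-k)
    rw [neg_neg] at this
    simpa [sub_eq_zero] using this
  exact hker hq

/-- The Fourier coefficients of a product with a monomial. -/
theorem integralAgainst_mulL1_torusMonomial (f : Lp ℂ 2 ν) (k n : Fin p → ℤ) :
    integralAgainst ν (UnitAddTorus.mFourier (-k)) (mulL1 ν f (torusMonomial ν n)) =
      ⟪torusMonomial ν (k - n), f⟫_ℂ := by
  rw [integralAgainst_mulL1, L2.inner_def]
  refine integral_congr_ae ?_
  filter_upwards [coeFn_torusMonomial (ν := ν) n, coeFn_torusMonomial (ν := ν) (k - n)]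
    with x h1 h2
  rw [h1, h2, RCLike.inner_apply, ← UnitAddTorus.mFourier_neg, neg_sub, sub_eq_neg_add,
    UnitAddTorus.mFourier_add]
  ring

theorem integralAgainst_mulL1_zero (f : Lp ℂ 2 ν) (k : Fin p → ℤ) :
    integralAgainst ν (UnitAddTorus.mFourier (-k)) (mulL1 ν f (torusMonomial ν 0)) =
      ⟪torusMonomial ν k, f⟫_ℂ := by
  rw [integralAgainst_mulL1_torusMonomial, sub_zero]

/-- The monomial of exponent zero is the constant one, so multiplying by it is the inclusion of L²
in L¹. This lets a product in L¹ be compared with an element of L². -/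
theorem mulL1_torusMonomial_zero (f : Lp ℂ 2 ν) :
    mulL1 ν f (torusMonomial ν 0) =ᵐ[ν] f := by
  filter_upwards [coeFn_mulL1 f (torusMonomial ν 0), coeFn_torusMonomial (ν := ν) 0] with x h1 h2
  simp [h1, h2, UnitAddTorus.mFourier_zero]

theorem ae_eq_mul_iff_mulL1_eq (f g u : Lp ℂ 2 ν) :
    (u =ᵐ[ν] fun x => f x * g x) ↔ mulL1 ν f g = mulL1 ν u (torusMonomial ν 0) := by
  rw [Lp.ext_iff]
  constructor
  · intro h
    exact (coeFn_mulL1 f g).trans (h.symm.trans (mulL1_torusMonomial_zero u).symm)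
  · intro h
    exact (mulL1_torusMonomial_zero u).symm.trans (h.symm.trans (coeFn_mulL1 f g))

/-- An element of `L²(dν)` is the product of two others if and only if the Fourier coefficients
agree. -/
theorem ae_eq_mul_iff (f g u : Lp ℂ 2 ν) :
    (u =ᵐ[ν] fun x => f x * g x) ↔ ∀ k,
      integralAgainst ν (UnitAddTorus.mFourier (-k)) (mulL1 ν f g) = ⟪torusMonomial ν k, u⟫_ℂ := by
  rw [ae_eq_mul_iff_mulL1_eq]
  simp only [← integralAgainst_mulL1_zero u]
  exact ⟨fun h k => by rw [h], L1_ext_mFourier⟩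

/-- A closed condition that holds for the monomials holds on `H₂(dν)`. -/
theorem H2_induction {P : Submodule ℂ (Lp ℂ 2 ν)} (hP : IsClosed (P : Set (Lp ℂ 2 ν)))
    (h : ∀ α : Fin p → ℕ, torusMonomial ν (fun i => (α i : ℤ)) ∈ P) : H2 ν ≤ P :=
  Submodule.topologicalClosure_minimal _
    (Submodule.span_le.2 (by rintro _ ⟨α, rfl⟩; exact h α)) hP

theorem H2_hom_ext {E : Type*} [NormedAddCommGroup E] [NormedSpace ℂ E] {A B : H2 ν →L[ℂ] E}
    (h : ∀ α, A (H2Monomial ν α) = B (H2Monomial ν α)) : A = B := by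
  -- The density argument runs in the ambient L²(dν); the equality locus, closed in H₂(dν), stays
  -- closed there because H₂(dν) is itself closed.
  have hle : H2 ν ≤ (LinearMap.eqLocus A.toLinearMap B.toLinearMap).map (H2 ν).subtype := by
    refine H2_induction ?_ fun α => ⟨H2Monomial ν α, h α, rfl⟩
    rw [Submodule.map_coe]
    exact (isClosed_H2 ν).isClosedEmbedding_subtypeVal.isClosedMap _
      (isClosed_eq A.continuous B.continuous)
  ext f
  obtain ⟨g, hg, hgf⟩ := hle f.2
  have : g = f := Subtype.ext hgf
  exact this ▸ hg

/-- Multiplying by z ^ α shifts the coefficient at k to the one at k - α, whose i-th entry is still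
negative. Density is used twice: in f for each monomial g, then in g. -/
theorem integralAgainst_mulL1_eq_zero {f g : Lp ℂ 2 ν} (hON : Orthonormal ℂ (torusMonomial ν))
    (hf : f ∈ H2 ν) (hg : g ∈ H2 ν) {k : Fin p → ℤ} (hk : ∃ i, k i < 0) :
    integralAgainst ν (UnitAddTorus.mFourier (-k)) (mulL1 ν f g) = 0 := by
  obtain ⟨i, hi⟩ := hk
  have h1 : ∀ α : Fin p → ℕ, integralAgainst ν (UnitAddTorus.mFourier (-k))
      (mulL1 ν f (torusMonomial ν fun i => (α i : ℤ))) = 0 := by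
    intro α
    rw [integralAgainst_mulL1_torusMonomial]
    refine H2_induction (P := LinearMap.ker (innerSL ℂ (torusMonomial ν
      (k - fun i => (α i : ℤ)))).toLinearMap) (ContinuousLinearMap.isClosed_ker _)
      (fun β => ?_) hf
    refine hON.2 fun h => ?_
    have := congrFun h i
    simp only [Pi.sub_apply] at this
    omega
  exact H2_induction (P := LinearMap.ker (integralAgainst ν (UnitAddTorus.mFourier (-k)) ∘L
    mulL1 ν f).toLinearMap) (ContinuousLinearMap.isClosed_ker _) h1 hg

theorem inner_torusMonomial_eq_zero {f : Lp ℂ 2 ν} (hON : Orthonormal ℂ (torusMonomial ν))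
    (hf : f ∈ H2 ν) {k : Fin p → ℤ} (hk : ∃ i, k i < 0) : ⟪torusMonomial ν k, f⟫_ℂ = 0 := by
  rw [← integralAgainst_mulL1_zero]
  refine integralAgainst_mulL1_eq_zero hON hf ?_ hk
  exact (H2Monomial ν 0).2

end TorusProducts

/-! ### Coefficients and values in H₂(𝔻) ⊗ H₂(dν). -/

section HardyTensor

theorem lp_two_hasSum_norm_sq {ι : Type*} {E : ι → Type*} [∀ i, NormedAddCommGroup (E i)]
    (F : lp E 2) : HasSum (fun i => ‖F i‖ ^ 2) (‖F‖ ^ 2) := by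
  simpa using lp.hasSum_norm (by norm_num) F

theorem memℓp_two_of_summable {ι : Type*} {E : ι → Type*} [∀ i, NormedAddCommGroup (E i)]
    {f : ∀ i, E i} (hf : Summable fun i => ‖f i‖ ^ 2) : Memℓp f 2 :=
  memℓp_gen (by simpa using hf)

variable {p : ℕ} {ν : Measure (UnitAddTorus (Fin p))} [IsFiniteMeasure ν]

theorem HardyTensor.norm_coeff_le (F : HardyTensor ν) (n : ℕ) :
    ‖(F n : Lp ℂ 2 ν)‖ ≤ ‖F‖ :=
  lp.norm_apply_le_norm two_ne_zero F n

theorem HardyTensor.hasSum_eval (F : HardyTensor ν) (z : Complex.UnitDisc) :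
    HasSum (fun n => (z : ℂ) ^ n • (F n : Lp ℂ 2 ν)) (F.eval z) :=
  (summable_pow_smul_of_norm_le F.norm_coeff_le z.norm_lt_one).hasSum

theorem HardyTensor.eval_mem (F : HardyTensor ν) (z : Complex.UnitDisc) : F.eval z ∈ H2 ν :=
  (isClosed_H2 ν).mem_of_tendsto (F.hasSum_eval z) (.of_forall fun _ =>
    Submodule.sum_mem _ fun n _ => Submodule.smul_mem _ _ (F n).2)

end HardyTensor

/-! ### The Hermite transform as an isometry, and part (a). -/

namespace ScaleGenerators

variable {p : ℕ} (S : ScaleGenerators p)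

/-- The parametrization `n ↦ γ ^ n` of `Γ`. -/
def γpowEquiv : (Fin p → ℤ) ≃ S.Grp :=
  Equiv.ofBijective S.γpow ⟨S.γpow_injective, S.γpow_surjective⟩

variable {S} {μ : Measure S.Dual} [IsProbabilityMeasure μ] [μ.IsMulLeftInvariant]
  {ν : Measure (UnitAddTorus (Fin p))} [IsFiniteMeasure ν] (hν : S.HasMoments μ ν)
include hν

/-- The monomials, reindexed by Γ, form an orthonormal family, which gives the isometry. Its range
is closed, since ℓ₂(Γ) is complete, and contains the monomials. -/
theorem exists_linearIsometry_hermite_fourier :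
    ∃ V : S.L2 →ₗᵢ[ℂ] Lp ℂ 2 ν, (∀ u, V u = S.hermite μ ν (S.fourier μ u)) ∧
      H2 ν ≤ LinearMap.range V.toLinearMap := by
  classical
  have hON := (S.orthonormal_torusMonomial hν).comp S.γpowEquiv.symm S.γpowEquiv.symm.injective
  have key : ∀ u : S.L2, hON.orthogonalFamily.linearIsometry u =
      S.hermite μ ν (S.fourier μ u) := by
    intro u
    have h1 := hON.orthogonalFamily.hasSum_linearIsometry u
    rw [← S.γpowEquiv.hasSum_iff] at h1
    refine h1.unique ((S.hasSum_hermite_fourier hν u).congr_fun fun n => ?_)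
    simp only [Function.comp_apply, LinearIsometry.toSpanSingleton_apply,
      Equiv.symm_apply_apply]
    rfl
  refine ⟨hON.orthogonalFamily.linearIsometry, key, H2_induction ?_ fun α => ?_⟩
  · exact hON.orthogonalFamily.linearIsometry.isometry.isClosedEmbedding.isClosed_range
  · refine ⟨lp.single 2 (S.γpow fun i => (α i : ℤ)) 1, ?_⟩
    refine (hON.orthogonalFamily.linearIsometry_apply_single (1 : ℂ)).trans ?_
    have : S.γpowEquiv.symm (S.γpow fun i => (α i : ℤ)) = fun i => (α i : ℤ) :=
      S.γpowEquiv.symm_apply_apply _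
    simp [this]

theorem norm_hermite_fourier (u : S.L2) : ‖S.hermite μ ν (S.fourier μ u)‖ = ‖u‖ := by
  obtain ⟨V, hV, -⟩ := exists_linearIsometry_hermite_fourier hν
  rw [← hV, V.norm_map]

theorem inner_hermite_fourier (u : S.L2) (k : Fin p → ℤ) :
    ⟪torusMonomial ν k, S.hermite μ ν (S.fourier μ u)⟫_ℂ = u (S.γpow k) := by
  have hON := S.orthonormal_torusMonomial hν
  have h := (S.hasSum_hermite_fourier hν u).mapL (innerSL ℂ (torusMonomial ν k))
  have h2 := hasSum_single (f := fun n => innerSL ℂ (torusMonomial ν k)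
    (u (S.γpow n) • torusMonomial ν n)) k fun n hn => by
      simp [hON.2 hn.symm]
  have h3 := h.unique h2
  simpa [inner_smul_right, inner_self_eq_norm_sq_to_K, hON.1 k] using h3

theorem exists_hermite_fourier_eq {f : Lp ℂ 2 ν} (hf : f ∈ H2 ν) :
    ∃ u ∈ S.L2Plus, S.hermite μ ν (S.fourier μ u) = f := by
  obtain ⟨V, hV, hle⟩ := exists_linearIsometry_hermite_fourier hν
  obtain ⟨u, rfl⟩ := hle hf
  refine ⟨u, fun g hg => ?_, (hV u).symm⟩
  obtain ⟨n, rfl⟩ := S.γpow_surjective g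
  rw [← inner_hermite_fourier hν, ← hV]
  -- Outside Γ₊ some exponent is negative, and there the coefficients of an element of H₂(dν)
  -- vanish.
  refine inner_torusMonomial_eq_zero (S.orthonormal_torusMonomial hν) hf ?_
  by_contra! hn
  refine hg ⟨fun i => (n i).toNat, ?_⟩
  simp only [Int.toNat_of_nonneg (hn _)]

/-- The Hermite transform takes convolutions to products. -/
theorem integralAgainst_mulL1_hermite_fourier (h u : S.L2) (k : Fin p → ℤ) :
    integralAgainst ν (UnitAddTorus.mFourier (-k))
      (mulL1 ν (S.hermite μ ν (S.fourier μ h)) (S.hermite μ ν (S.fourier μ u))) =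
      S.conv h u (S.γpow k) := by
  have h1 := (S.hasSum_hermite_fourier hν u).mapL
    (integralAgainst ν (UnitAddTorus.mFourier (-k)) ∘L mulL1 ν (S.hermite μ ν (S.fourier μ h)))
  refine h1.tsum_eq.symm.trans ?_
  rw [conv, ← S.γpowEquiv.tsum_eq]
  refine tsum_congr fun n => ?_
  change _ = h (S.γpow k * (S.γpow n)⁻¹) * u (S.γpow n)
  rw [map_smul, ContinuousLinearMap.comp_apply, integralAgainst_mulL1_torusMonomial,
    inner_hermite_fourier hν, sub_eq_add_neg, γpow_add, γpow_neg, smul_eq_mul]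
  exact mul_comm _ _

variable {h : ℕ → S.L2}

theorem hasSum_transferFunction (hbdd : BddAbove (Set.range fun n => ‖h n‖))
    (z : Complex.UnitDisc) :
    HasSum (fun n => (z : ℂ) ^ n • S.hermite μ ν (S.fourier μ (h n)))
      (S.transferFunction μ ν h z) := by
  obtain ⟨C, hC⟩ := hbdd
  refine (summable_pow_smul_of_norm_le (C := C) (fun n => ?_) z.norm_lt_one).hasSum
  rw [norm_hermite_fourier hν]
  exact hC ⟨n, rfl⟩

/-- The output of the system in terms of the Fourier coefficients of the product of the transfer
function and the input. -/
theorem hasSum_output (hbdd : BddAbove (Set.range fun n => ‖h n‖)) {u : ℕ → S.L2}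
    {F : HardyTensor ν} (hF : ∀ n, (F n : Lp ℂ 2 ν) = S.hermite μ ν (S.fourier μ (u n)))
    (k : Fin p → ℤ) (z : Complex.UnitDisc) :
    HasSum (fun n => (z : ℂ) ^ n * S.output h u n (S.γpow k))
      (integralAgainst ν (UnitAddTorus.mFourier (-k))
        (mulL1 ν (S.transferFunction μ ν h z) (F.eval z))) := by
  have hT := hasSum_transferFunction hν hbdd z
  obtain ⟨C, hC⟩ := hbdd
  have h1 := hasSum_pow_mul_bilin
    ((ContinuousLinearMap.compL ℂ _ _ _ (integralAgainst ν (UnitAddTorus.mFourier (-k)))).comp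
      (mulL1 ν)) (f := fun n => S.hermite μ ν (S.fourier μ (h n))) (g := fun n => (F n : Lp ℂ 2 ν))
    (C := C) (fun n => by rw [norm_hermite_fourier hν]; exact hC ⟨n, rfl⟩) F.norm_coeff_le
    z.norm_lt_one hT (F.hasSum_eval z)
  refine h1.congr_fun fun n => ?_
  rw [output]
  congr 1
  refine Finset.sum_congr rfl fun m _ => ?_
  rw [← integralAgainst_mulL1_hermite_fourier hν, ← hF]
  rfl

omit hν in
theorem _root_.HardyTensor.hasSum_inner_eval (G : HardyTensor ν) (k : Fin p → ℤ)
    (z : Complex.UnitDisc) :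
    HasSum (fun n => (z : ℂ) ^ n * ⟪torusMonomial ν k, G n⟫_ℂ)
      ⟪torusMonomial ν k, G.eval z⟫_ℂ := by
  simpa [inner_smul_right] using (G.hasSum_eval z).mapL (innerSL ℂ (torusMonomial ν k))

/-- For each k the Fourier coefficients at k of both sides are power series in z, with coefficients
`y_n(γ ^ k)` and the output at `γ ^ k`; these series agree on the disc exactly when their
coefficients do. -/
theorem forall_eval_ae_eq_mul_iff (hbdd : BddAbove (Set.range fun n => ‖h n‖)) {u y : ℕ → S.L2}
    {F G : HardyTensor ν} (hF : ∀ n, (F n : Lp ℂ 2 ν) = S.hermite μ ν (S.fourier μ (u n)))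
    (hG : ∀ n, (G n : Lp ℂ 2 ν) = S.hermite μ ν (S.fourier μ (y n))) :
    (∀ z, G.eval z =ᵐ[ν] fun x => S.transferFunction μ ν h z x * F.eval z x) ↔
      ∀ n g, y n g = S.output h u n g := by
  simp only [ae_eq_mul_iff]
  have hGk : ∀ k (z : Complex.UnitDisc), HasSum (fun n => (z : ℂ) ^ n * y n (S.γpow k))
      ⟪torusMonomial ν k, G.eval z⟫_ℂ := fun k z => by
    refine (G.hasSum_inner_eval k z).congr_fun fun n => ?_
    rw [hG, inner_hermite_fourier hν]
  constructor
  · intro H n g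
    obtain ⟨k, rfl⟩ := S.γpow_surjective g
    refine congrFun (eq_of_hasSum_pow_mul (b := fun n => S.output h u n (S.γpow k)) (hGk k)
      fun z => ?_) n
    rw [← H z k]
    exact hasSum_output hν hbdd hF k z
  · intro H z k
    have h1 := hGk k z
    simp only [H] at h1
    exact (hasSum_output hν hbdd hF k z).unique h1

/-- A square summable sequence in `ℓ₂(Γ₊)` as an element of `H₂(𝔻) ⊗ H₂(dν)`. -/
theorem exists_hardyTensor {u : ℕ → S.L2} (hu : ∀ n, u n ∈ S.L2Plus)
    (hs : Summable fun n => ‖u n‖ ^ 2) :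
    ∃ F : HardyTensor ν, (∀ n, (F n : Lp ℂ 2 ν) = S.hermite μ ν (S.fourier μ (u n))) := by
  refine ⟨⟨fun n => ⟨_, S.hermite_fourier_mem_H2 hν (hu n)⟩, memℓp_two_of_summable ?_⟩,
    fun n => rfl⟩
  simpa only [Submodule.coe_norm, norm_hermite_fourier hν] using hs

theorem _root_.HardyTensor.hasSum_norm_sq {u : ℕ → S.L2} {F : HardyTensor ν}
    (hF : ∀ n, (F n : Lp ℂ 2 ν) = S.hermite μ ν (S.fourier μ (u n))) :
    HasSum (fun n => ‖u n‖ ^ 2) (‖F‖ ^ 2) := by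
  have h1 := lp_two_hasSum_norm_sq F
  simpa only [Submodule.coe_norm, hF, norm_hermite_fourier hν] using h1

theorem scaleCausalDissipative_iff (hbdd : BddAbove (Set.range fun n => ‖h n‖)) :
    S.ScaleCausalDissipative h ↔ IsContractiveMultiplier ν (S.transferFunction μ ν h) := by
  constructor
  · rintro ⟨-, H⟩ F
    choose u hu huF using fun n => exists_hermite_fourier_eq hν (F n).2
    have hF := HardyTensor.hasSum_norm_sq hν (F := F) fun n => (huF n).symm
    obtain ⟨y, hy, hyo, hys, hle⟩ := H u hu hF.summable
    obtain ⟨G, hG⟩ := exists_hardyTensor hν hy hys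
    refine ⟨G, ?_, (forall_eval_ae_eq_mul_iff hν hbdd (fun n => (huF n).symm) hG).2 hyo⟩
    rwa [hF.tsum_eq, (HardyTensor.hasSum_norm_sq hν hG).tsum_eq,
      sq_le_sq₀ (norm_nonneg _) (norm_nonneg _)] at hle
  · intro H
    have H2 : ∀ u : ℕ → S.L2, (∀ n, u n ∈ S.L2Plus) → Summable (fun n => ‖u n‖ ^ 2) →
        ∃ y : ℕ → S.L2, (∀ n, y n ∈ S.L2Plus) ∧ (∀ n g, y n g = S.output h u n g) ∧
          Summable (fun n => ‖y n‖ ^ 2) ∧ ∑' n, ‖y n‖ ^ 2 ≤ ∑' n, ‖u n‖ ^ 2 := by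
      intro u hu hus
      obtain ⟨F, hF⟩ := exists_hardyTensor hν hu hus
      obtain ⟨G, hGF, hG⟩ := H F
      choose y hy hyG using fun n => exists_hermite_fourier_eq hν (G n).2
      have hGs := HardyTensor.hasSum_norm_sq hν (F := G) fun n => (hyG n).symm
      refine ⟨y, hy, (forall_eval_ae_eq_mul_iff hν hbdd hF fun n => (hyG n).symm).1 hG,
        hGs.summable, ?_⟩
      rw [hGs.tsum_eq, (HardyTensor.hasSum_norm_sq hν hF).tsum_eq]
      gcongr
    -- Feed in u at time 0 and nothing later: the output at time n is h_n ⋆ u, so dissipativity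
    -- bounds its norm by that of u, whence the constant 1.
    refine ⟨fun n => ⟨1, fun u hu => ?_⟩, H2⟩
    have h0 : ∀ m ≠ 0, Pi.single (M := fun _ : ℕ => S.L2) 0 u m = 0 :=
      fun m hm => Pi.single_eq_of_ne hm _
    have hs : HasSum (fun m => ‖Pi.single (M := fun _ : ℕ => S.L2) 0 u m‖ ^ 2) (‖u‖ ^ 2) := by
      convert hasSum_single 0 fun m hm => ?_
      · simp
      · simp [h0 m hm]
    obtain ⟨y, hy, hyo, hys, hle⟩ := H2 (Pi.single 0 u) (fun m => by
      rcases eq_or_ne m 0 with rfl | hm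
      · simpa using hu
      · rw [h0 m hm]; exact S.L2Plus.zero_mem) hs.summable
    refine ⟨y n, hy n, fun g => ?_, ?_⟩
    · rw [hyo, output, Finset.sum_eq_single 0]
      · simp
      · intro m _ hm
        simp [h0 m hm, conv]
      · simp
    · rw [hs.tsum_eq] at hle
      rw [one_mul, ← sq_le_sq₀ (norm_nonneg _) (norm_nonneg _)]
      exact (hys.le_tsum n fun _ _ => by positivity).trans hle

end ScaleGenerators

/-! ### From values on the polydisc to Fourier coefficients on the torus. -/

section Polydisc

theorem summable_prod_pow {p : ℕ} {r : Fin p → ℝ} (h0 : ∀ i, 0 ≤ r i) (h1 : ∀ i, r i < 1) :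
    Summable fun α : Fin p → ℕ => ∏ i, r i ^ α i := by
  induction p with
  | zero => exact (hasSum_fintype _).summable
  | succ p ih =>
    rw [← (Fin.consEquiv fun _ => ℕ).summable_iff]
    have h2 : Summable fun α : Fin p → ℕ => ∏ i, r i.succ ^ α i :=
      ih (fun i => h0 _) fun i => h1 _
    have h3 := (summable_geometric_of_lt_one (h0 0) (h1 0)).mul_of_nonneg h2
      (fun n => pow_nonneg (h0 0) n) fun α => Finset.prod_nonneg fun i _ => pow_nonneg (h0 _) _
    refine h3.congr fun q => ?_
    simp [Fin.prod_univ_succ, Fin.consEquiv]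

variable {p : ℕ}

theorem summable_norm_prod_pow (w : Fin p → Complex.UnitDisc) :
    Summable fun α : Fin p → ℕ => ‖∏ i, (w i : ℂ) ^ α i‖ := by
  simp only [norm_prod, norm_pow]
  exact summable_prod_pow (fun i => norm_nonneg _) fun i => (w i).norm_lt_one

/-- The function `∑ w^α z^{-α}` on the torus. -/
def polydiscKernel (w : Fin p → Complex.UnitDisc) : C(UnitAddTorus (Fin p), ℂ) :=
  ∑' α : Fin p → ℕ, (∏ i, (w i : ℂ) ^ α i) • UnitAddTorus.mFourier (-fun i => (α i : ℤ))

theorem hasSum_polydiscKernel (w : Fin p → Complex.UnitDisc) :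
    HasSum (fun α : Fin p → ℕ => (∏ i, (w i : ℂ) ^ α i) •
      UnitAddTorus.mFourier (-fun i => (α i : ℤ))) (polydiscKernel w) := by
  refine Summable.hasSum (Summable.of_norm ?_)
  simpa only [norm_smul, UnitAddTorus.mFourier_norm, mul_one] using summable_norm_prod_pow w

variable {ν : Measure (UnitAddTorus (Fin p))} [IsFiniteMeasure ν]

/-- Pairing with `polydiscKernel w` evaluates at w the power series formed from the Fourier
coefficients of g with nonnegative index. -/
theorem hasSum_integralAgainst_polydiscKernel (w : Fin p → Complex.UnitDisc) (g : Lp ℂ 1 ν) :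
    HasSum (fun α : Fin p → ℕ => (∏ i, (w i : ℂ) ^ α i) *
      integralAgainst ν (UnitAddTorus.mFourier (-fun i => (α i : ℤ))) g)
      (integralAgainst ν (polydiscKernel w) g) := by
  simpa using (hasSum_polydiscKernel w).mapL ((integralAgainst ν).flip g)

/-- The Fourier coefficients with nonnegative indices are determined by the values of the
corresponding power series on the polydisc. -/
theorem integralAgainst_mFourier_eq_zero (hON : Orthonormal ℂ (torusMonomial ν)) {g : Lp ℂ 1 ν}
    (hg : ∀ w, integralAgainst ν (polydiscKernel w) g = 0) (β : Fin p → ℕ) :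
    integralAgainst ν (UnitAddTorus.mFourier (-fun i => (β i : ℤ))) g = 0 := by
  let c : (Fin p → ℕ) → ℂ := fun α =>
    integralAgainst ν (UnitAddTorus.mFourier (-fun i => (α i : ℤ))) g
  -- Any radius in (0, 1) would do. On the torus of radius r the power series of g becomes a
  -- uniformly convergent trigonometric series with coefficients r^|α| c α, and it vanishes
  -- identically. Its inner product in L²(dν) with the monomial of index β isolates r^|β| c β.
  let r : ℝ := 1 / 2
  have hc : ∀ α, ‖c α‖ ≤ ‖integralAgainst ν‖ * ‖g‖ := fun α => by
    have := (integralAgainst ν).le_opNorm₂ (UnitAddTorus.mFourier (-fun i => (α i : ℤ))) g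
    rwa [UnitAddTorus.mFourier_norm, mul_one] at this
  have hs : Summable fun α : Fin p → ℕ =>
      ((∏ i, (r : ℂ) ^ α i) * c α) • UnitAddTorus.mFourier (d := Fin p) fun i => (α i : ℤ) := by
    refine Summable.of_norm_bounded ((summable_prod_pow (p := p) (r := fun _ => r)
      (fun _ => by norm_num [r]) fun _ => by norm_num [r]).mul_right (‖integralAgainst ν‖ * ‖g‖))
      fun α => ?_
    rw [norm_smul, UnitAddTorus.mFourier_norm, mul_one, norm_mul, norm_prod]
    refine mul_le_mul (le_of_eq ?_) (hc α) (norm_nonneg _)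
      (Finset.prod_nonneg fun i _ => by norm_num [r])
    simp [r]
  have h0 : ∑' α : Fin p → ℕ,
      ((∏ i, (r : ℂ) ^ α i) * c α) • UnitAddTorus.mFourier (d := Fin p) (fun i => (α i : ℤ)) =
        0 := by
    ext x
    have h1 := hs.hasSum.mapL (ContinuousMap.evalCLM ℂ x)
    have hr : ∀ i, ‖(r : ℂ) * fourier 1 (x i)‖ < 1 := fun i => by
      have : ‖(fourier 1 (x i) : ℂ)‖ = 1 := by
        rw [fourier_apply]
        exact Circle.norm_coe _
      rw [norm_mul, this]
      norm_num [r]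
    have h2 := hasSum_integralAgainst_polydiscKernel
      (fun i => Complex.UnitDisc.mk ((r : ℂ) * fourier 1 (x i)) (hr i)) g
    rw [hg] at h2
    refine h1.unique (h2.congr_fun fun α => ?_)
    simp only [map_smul, ContinuousMap.evalCLM_apply, Complex.UnitDisc.coe_mk, mul_pow,
      Finset.prod_mul_distrib, smul_eq_mul, c]
    have h3 : ∀ i, (fourier (α i : ℤ) (x i) : ℂ) = fourier 1 (x i) ^ α i := fun i => by
      rw [fourier_apply, fourier_apply, AddCircle.toCircle_zsmul, one_zsmul, Circle.coe_zpow,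
        zpow_natCast]
    have h4 : UnitAddTorus.mFourier (fun i => (α i : ℤ)) x = ∏ i, fourier 1 (x i) ^ α i := by
      simp only [UnitAddTorus.mFourier, ContinuousMap.coe_mk, h3]
    rw [h4]
    ring
  have h1 := hs.hasSum
  rw [h0] at h1
  have h2 := h1.mapL ((innerSL ℂ (torusMonomial ν fun i => (β i : ℤ))) ∘L
    (ContinuousMap.toLp 2 ν ℂ))
  have h3 := hasSum_single (f := fun α : Fin p → ℕ =>
    ((innerSL ℂ (torusMonomial ν fun i => (β i : ℤ))) ∘L (ContinuousMap.toLp 2 ν ℂ))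
      (((∏ i, (r : ℂ) ^ α i) * c α) • UnitAddTorus.mFourier (d := Fin p) fun i => (α i : ℤ))) β
    fun α hα => by
      have h5 : ⟪torusMonomial ν fun i => (β i : ℤ), torusMonomial ν fun i => (α i : ℤ)⟫_ℂ = 0 :=
        hON.2 fun h => hα (funext fun i => by exact_mod_cast (congrFun h i).symm)
      rw [map_smul, ContinuousLinearMap.comp_apply, innerSL_apply_apply]
      exact (congrArg _ h5).trans (smul_zero _)
  have h4 := h2.unique h3
  have h5 : ⟪torusMonomial ν fun i => (β i : ℤ), torusMonomial ν fun i => (β i : ℤ)⟫_ℂ = 1 := by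
    rw [inner_self_eq_norm_sq_to_K, hON.1]
    simp
  rw [map_zero, map_smul, ContinuousLinearMap.comp_apply, innerSL_apply_apply] at h4
  have h6 := h4.trans (congrArg (fun t => ((∏ i, (r : ℂ) ^ β i) * c β) • t) h5)
  have hr0 : (∏ i, (r : ℂ) ^ β i) ≠ 0 :=
    Finset.prod_ne_zero_iff.2 fun i _ => pow_ne_zero _ (by norm_num [r])
  simpa [hr0] using h6.symm

/-- Evaluation at a point of the polydisc of the elements of a reproducing kernel Hilbert space
`H₂(dν)`. -/
def evalAt [RKHS ℂ (H2 ν) (Fin p → Complex.UnitDisc) ℂ] (w : Fin p → Complex.UnitDisc) :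
    H2 ν →L[ℂ] ℂ :=
  (ContinuousLinearMap.proj w).comp (RKHS.coeCLM ℂ)

variable [RKHS ℂ (H2 ν) (Fin p → Complex.UnitDisc) ℂ]

/-- Both sides are bounded bilinear forms on H₂(dν), so monomials suffice. The only nonzero
coefficient of z^a z^b is at a + b, and both sides equal w^(a + b). Thus evaluation in the
reproducing kernel space agrees with the power series and is multiplicative. -/
theorem integralAgainst_polydiscKernel (hON : Orthonormal ℂ (torusMonomial ν))
    (hmon : ∀ (α : Fin p → ℕ) (w : Fin p → Complex.UnitDisc),
      RKHS.coeCLM ℂ (H2Monomial ν α) w = ∏ i, (w i : ℂ) ^ α i)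
    (w : Fin p → Complex.UnitDisc) (f g : H2 ν) :
    integralAgainst ν (polydiscKernel w) (mulL1 ν f g) = evalAt w f * evalAt w g := by
  have hm : ∀ α, evalAt w (H2Monomial ν α) = ∏ i, (w i : ℂ) ^ α i := fun α => hmon α w
  have key : ∀ a b, integralAgainst ν (polydiscKernel w)
      (mulL1 ν (H2Monomial ν a : Lp ℂ 2 ν) (H2Monomial ν b : Lp ℂ 2 ν)) =
      evalAt w (H2Monomial ν a) * evalAt w (H2Monomial ν b) := by
    intro a b
    have h1 := hasSum_integralAgainst_polydiscKernel w
      (mulL1 ν (H2Monomial ν a : Lp ℂ 2 ν) (H2Monomial ν b : Lp ℂ 2 ν))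
    have h2 : ∀ α : Fin p → ℕ, integralAgainst ν (UnitAddTorus.mFourier (-fun i => (α i : ℤ)))
        (mulL1 ν (H2Monomial ν a : Lp ℂ 2 ν) (H2Monomial ν b : Lp ℂ 2 ν)) =
        ⟪torusMonomial ν ((fun i => (α i : ℤ)) - fun i => (b i : ℤ)),
          torusMonomial ν fun i => (a i : ℤ)⟫_ℂ :=
      fun α => integralAgainst_mulL1_torusMonomial _ _ _
    simp only [h2] at h1
    have h3 := h1.unique (hasSum_single (a + b) fun α hα => by
      rw [hON.2, mul_zero]
      intro h
      refine hα (funext fun i => ?_)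
      have := congrFun h i
      simp only [Pi.sub_apply] at this
      simp only [Pi.add_apply]
      omega)
    have h4 : ((fun i => (((a + b) i : ℕ) : ℤ)) - fun i => (b i : ℤ)) = fun i => (a i : ℤ) := by
      funext i
      simp
    rw [h3, h4, inner_self_eq_norm_sq_to_K, hON.1, hm, hm, ← Finset.prod_mul_distrib]
    simp [pow_add]
  let B : H2 ν →L[ℂ] H2 ν →L[ℂ] ℂ :=
    ((ContinuousLinearMap.compL ℂ (Lp ℂ 2 ν) (Lp ℂ 1 ν) ℂ
      (integralAgainst ν (polydiscKernel w))).comp (mulL1 ν)).bilinearComp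
        (H2 ν).subtypeL (H2 ν).subtypeL
  let D : H2 ν →L[ℂ] H2 ν →L[ℂ] ℂ :=
    (ContinuousLinearMap.mul ℂ ℂ).bilinearComp (evalAt w) (evalAt w)
  have hB : B = D := by
    refine H2_hom_ext (E := H2 ν →L[ℂ] ℂ) fun a => ?_
    refine H2_hom_ext fun b => ?_
    exact key a b
  exact congrArg (fun A : H2 ν →L[ℂ] H2 ν →L[ℂ] ℂ => A f g) hB

/-- Both u and f g have vanishing coefficients at indices with a negative entry. The remaining ones
are determined by the values on the polydisc, where f g takes the product of the values of f and g.
-/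
theorem ae_eq_mul_iff_evalAt (hON : Orthonormal ℂ (torusMonomial ν))
    (hmon : ∀ (α : Fin p → ℕ) (w : Fin p → Complex.UnitDisc),
      RKHS.coeCLM ℂ (H2Monomial ν α) w = ∏ i, (w i : ℂ) ^ α i) (f g u : H2 ν) :
    ((u : Lp ℂ 2 ν) =ᵐ[ν] fun x => (f : Lp ℂ 2 ν) x * (g : Lp ℂ 2 ν) x) ↔
      ∀ w, evalAt w u = evalAt w f * evalAt w g := by
  -- Writing u as u · 1 makes the product formula compute its own values.
  have hu : ∀ w, integralAgainst ν (polydiscKernel w) (mulL1 ν u (torusMonomial ν 0)) =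
      evalAt w u := fun w => by
    have h1 : evalAt w (H2Monomial ν 0) = 1 := (hmon 0 w).trans (by simp)
    have h2 := integralAgainst_polydiscKernel hON hmon w u (H2Monomial ν 0)
    rw [h1, mul_one] at h2
    exact h2
  constructor
  · intro h w
    rw [← integralAgainst_polydiscKernel hON hmon, ← hu, (ae_eq_mul_iff_mulL1_eq _ _ _).1 h]
  · intro h
    rw [ae_eq_mul_iff]
    intro k
    by_cases hk : ∃ i, k i < 0
    · rw [integralAgainst_mulL1_eq_zero hON f.2 g.2 hk, inner_torusMonomial_eq_zero hON u.2 hk]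
    · push Not at hk
      obtain ⟨α, rfl⟩ : ∃ α : Fin p → ℕ, k = fun i => (α i : ℤ) :=
        ⟨fun i => (k i).toNat, funext fun i => (Int.toNat_of_nonneg (hk i)).symm⟩
      rw [← integralAgainst_mulL1_zero, ← sub_eq_zero, ← map_sub]
      refine integralAgainst_mFourier_eq_zero hON (fun w => ?_) α
      rw [map_sub, hu, integralAgainst_polydiscKernel hON hmon, h, sub_self]

/-- The kernel function of `H₂(𝔻) ⊗ H₂(dν)` at a point of `𝔻 × 𝔻ᵖ`. -/
def hardyKernel (x : Complex.UnitDisc × (Fin p → Complex.UnitDisc)) : HardyTensor ν :=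
  ⟨fun n => (conj (x.1 : ℂ)) ^ n • RKHS.kerFun (H2 ν) x.2 1, by
    refine memℓp_two_of_summable ?_
    have h1 : ‖(x.1 : ℂ)‖ ^ 2 < 1 :=
      (sq_lt_one_iff₀ (norm_nonneg _)).2 x.1.norm_lt_one
    refine ((summable_geometric_of_lt_one (sq_nonneg _) h1).mul_right
      (‖RKHS.kerFun (H2 ν) x.2 (1 : ℂ)‖ ^ 2)).congr fun n => ?_
    rw [norm_smul, norm_pow, RCLike.norm_conj, mul_pow]
    ring⟩

theorem hasSum_inner_hardyKernel (x : Complex.UnitDisc × (Fin p → Complex.UnitDisc))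
    (F : HardyTensor ν) :
    HasSum (fun n => (x.1 : ℂ) ^ n * evalAt x.2 (F n)) ⟪hardyKernel x, F⟫_ℂ := by
  have h1 : ∀ (n : ℕ) (f : H2 ν), (x.1 : ℂ) ^ n * evalAt x.2 f =
      ⟪(conj (x.1 : ℂ)) ^ n • RKHS.kerFun (H2 ν) x.2 1, f⟫_ℂ := fun n f => by
    refine Eq.trans ?_ (inner_smul_left (𝕜 := ℂ) (E := H2 ν) _ _ _).symm
    rw [RKHS.kerFun_inner, map_pow, RCLike.conj_conj]
    simp [evalAt]
  exact (lp.hasSum_inner (hardyKernel x) F).congr_fun fun n => h1 n (F n)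

theorem inner_hardyKernel (x : Complex.UnitDisc × (Fin p → Complex.UnitDisc))
    (F : HardyTensor ν) : ⟪hardyKernel x, F⟫_ℂ = evalAt x.2 ⟨F.eval x.1, F.eval_mem x.1⟩ := by
  refine (hasSum_inner_hardyKernel x F).unique ?_
  have h1 := (summable_pow_smul_of_norm_le (f := F) (lp.norm_apply_le_norm two_ne_zero F)
    x.1.norm_lt_one).hasSum
  have h2 : ∑' n, (x.1 : ℂ) ^ n • F n = ⟨F.eval x.1, F.eval_mem x.1⟩ :=
    Subtype.ext ((h1.mapL (H2 ν).subtypeL).unique (F.hasSum_eval x.1))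
  rw [h2] at h1
  simpa using h1.mapL (evalAt x.2)

/-- Summing the geometric series in z w^* gives the Szegő kernel of the disc times K. -/
theorem inner_hardyKernel_hardyKernel (x y : Complex.UnitDisc × (Fin p → Complex.UnitDisc)) :
    ⟪(hardyKernel x : HardyTensor ν), hardyKernel y⟫_ℂ =
      (1 - (x.1 : ℂ) * conj (y.1 : ℂ))⁻¹ * RKHS.kernel (H2 ν) x.2 y.2 1 := by
  refine (hasSum_inner_hardyKernel x (hardyKernel y)).unique ?_
  have h1 : ‖(x.1 : ℂ) * conj (y.1 : ℂ)‖ < 1 := by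
    rw [norm_mul, RCLike.norm_conj]
    exact mul_lt_one_of_nonneg_of_lt_one_left (norm_nonneg _) x.1.norm_lt_one y.1.norm_lt_one.le
  refine ((hasSum_geometric_of_norm_lt_one h1).mul_right _).congr_fun fun n => ?_
  rw [← RKHS.kerFun_apply, mul_pow, mul_assoc]
  congr 1
  change evalAt x.2 ((conj (y.1 : ℂ)) ^ n • RKHS.kerFun (H2 ν) y.2 1) = _
  rw [map_smul]
  rfl

end Polydisc

/-! ### Positivity of the kernel: part (b). -/

namespace ScaleGenerators

variable {p : ℕ} {S : ScaleGenerators p} {μ : Measure S.Dual} [IsProbabilityMeasure μ]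
  [μ.IsMulLeftInvariant] {ν : Measure (UnitAddTorus (Fin p))} [IsFiniteMeasure ν]

/-- The series of the transfer function converges in the closed subspace H₂(dν), since every
coefficient lies there, and continuous evaluation at w passes through the sum. -/
theorem exists_evalAt_eq_transferValue (hν : S.HasMoments μ ν)
    [RKHS ℂ (H2 ν) (Fin p → Complex.UnitDisc) ℂ] {h : ℕ → S.L2}
    (hbdd : BddAbove (Set.range fun n => ‖h n‖)) (hh : ∀ n, h n ∈ S.L2Plus)
    (z : Complex.UnitDisc) :
    ∃ f : H2 ν, (f : Lp ℂ 2 ν) = S.transferFunction μ ν h z ∧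
      ∀ w, evalAt w f = S.transferValue hν hh (z, w) := by
  have hT := hasSum_transferFunction hν hbdd z
  obtain ⟨C, hC⟩ := hbdd
  have h1 := (summable_pow_smul_of_norm_le (C := C) (f := fun n =>
    (⟨S.hermite μ ν (S.fourier μ (h n)), S.hermite_fourier_mem_H2 hν (hh n)⟩ : H2 ν))
    (fun n => by
      rw [Submodule.coe_norm, norm_hermite_fourier hν]
      exact hC ⟨n, rfl⟩) z.norm_lt_one).hasSum
  refine ⟨_, (h1.mapL (H2 ν).subtypeL).unique hT, fun w => ?_⟩
  refine (h1.mapL (evalAt w)).tsum_eq.symm.trans ?_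
  simp only [map_smul]
  rfl

theorem isContractiveMultiplier_iff_posSemidef (hν : S.HasMoments μ ν)
    [RKHS ℂ (H2 ν) (Fin p → Complex.UnitDisc) ℂ]
    (hmon : ∀ (α : Fin p → ℕ) (w : Fin p → Complex.UnitDisc),
      RKHS.coeCLM ℂ (H2Monomial ν α) w = ∏ i, (w i : ℂ) ^ α i) {h : ℕ → S.L2}
    (hbdd : BddAbove (Set.range fun n => ‖h n‖)) (hh : ∀ n, h n ∈ S.L2Plus) :
    IsContractiveMultiplier ν (S.transferFunction μ ν h) ↔
      (S.transferKernel hν hh).PosSemidef := by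
  have hker : S.transferKernel hν hh = Matrix.of fun x y =>
      (1 - S.transferValue hν hh x * conj (S.transferValue hν hh y)) *
        ⟪(hardyKernel x : HardyTensor ν), hardyKernel y⟫_ℂ := by
    ext x y
    simp only [transferKernel, Matrix.of_apply, inner_hardyKernel_hardyKernel, div_eq_mul_inv,
      mul_assoc]
  -- Both sides now ask for G with ‖G‖ ≤ ‖F‖. It remains to match, for each z, the almost everywhere
  -- product on the torus with the pointwise product on the polydisc.
  rw [hker, ← exists_norm_le_inner_eq_mul_iff_posSemidef]
  refine forall_congr' fun F => exists_congr fun G => and_congr_right fun _ => ?_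
  rw [Prod.forall]
  refine forall_congr' fun z => ?_
  obtain ⟨f, hf, hfe⟩ := exists_evalAt_eq_transferValue hν hbdd hh z
  simp only [inner_hardyKernel, ← hfe]
  rw [← hf]
  exact ae_eq_mul_iff_evalAt (S.orthonormal_torusMonomial hν) hmon f ⟨F.eval z, F.eval_mem z⟩
    ⟨G.eval z, G.eval_mem z⟩

end ScaleGenerators

end

theorem mainTheorem3 {p : ℕ} (S : ScaleGenerators p)
    (μ : Measure S.Dual) [μ.IsHaarMeasure] [IsProbabilityMeasure μ]
    (ν : Measure (UnitAddTorus (Fin p))) [IsFiniteMeasure ν] (hν : S.HasMoments μ ν)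
    (h : ℕ → S.L2) (hbdd : BddAbove (Set.range fun n => ‖h n‖)) :
    (S.ScaleCausalDissipative h ↔ IsContractiveMultiplier ν (S.transferFunction μ ν h)) ∧
    ∀ [RKHS ℂ (H2 ν) (Fin p → Complex.UnitDisc) ℂ],
      (∀ (α : Fin p → ℕ) (w : Fin p → Complex.UnitDisc),
        RKHS.coeCLM ℂ (H2Monomial ν α) w = ∏ i, (w i : ℂ) ^ α i) →
      ∀ hh : ∀ n, h n ∈ S.L2Plus,
        (IsContractiveMultiplier ν (S.transferFunction μ ν h) ↔
          (S.transferKernel hν hh).PosSemidef) :=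
  ⟨ScaleGenerators.scaleCausalDissipative_iff hν hbdd, fun hmon hh =>
    ScaleGenerators.isContractiveMultiplier_iff_posSemidef hν hmon hbdd hh⟩
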